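/- **Setting.** Let $f:\mathbb R^n\to\mathbb R$ be $\sigma$-strongly convex ($\sigma>0$, possibly nonsmooth), $A\in\mathbb R^{m\times n}$, $b\in\mathbb R^m$, $\mu>0$. Let $f^*$ be the Fenchel conjugate of $f$ and put $$h(z)=f^*(-A^\top z)-\langle z,b\rangle,\qquad F(z)=h(z)+\mu\|z\|_0+\delta_+(z),\qquad \ell_h=\|A\|^2/\sigma,$$ where $\|A\|$ is the Frobenius norm, $\|z\|_0$ is the number of nonzero entries of $z$, and $\delta_+(z)=0$ if $z\ge 0$, $\delta_+(z)=+\infty$ otherwise. For a locally Lipschitz map $\Phi$ let $\partial_C\Phi(x)$ be Clarke's generalized Jacobian (the convex hull of all limits of Jacobians $J\Phi(x^k)$ at differentiability points $x^k\to x$). $\Phi$ is *semismooth* if it is locally Lipschitz, directionally differentiable, and at every $x$, $\Phi(x+d)-\Phi(x)-Hd=o(\|d\|)$ as $d\to0$, uniformly in $H\in\partial_C\Phi(x+d)$; it is *strongly semismooth* if $o(\|d\|)$ can be replaced by $O(\|d\|^2)$. Put $$\widehat\partial^2h(z)=\{AQA^\top: Q\in\partial_C(\nabla f^*)(-A^\top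 z)\}.$$ For an index set $T$, $x_T$ denotes the subvector and $H_T$ the principal submatrix indexed by $T$, $\overline T$ is the complement of $T$, and $\nabla_Th(z)=(\nabla h(z))_T$. **Method (SGSN).** Fix $\tau\in(0,1/\ell_h)$ (any $\tau>0$ if $\ell_h=0$) and $c_1,c_2,\gamma>0$, and start from any $z^0\in\mathbb R^m$. Given $z^k$, let $T_k=\{i:[z^k-\tau\nabla h(z^k)]_i>\sqrt{2\tau\mu}\}$ and let $v^k_{T_k}=[z^k-\tau\nabla h(z^k)]_{T_k}$, $v^k_{\overline T_k}=0$. Choose any $H^k\in\widehat\partial^2h(v^k)$ and any solution $d^k_{T_k}$ of $$(H^k_{T_k}+\gamma\|\nabla_{T_k}h(v^k)\|I)\,d^k_{T_k}=-\nabla_{T_k}h(v^k).$$ Let $\alpha_k=\min\{1,\beta_k\}$, where $\beta_k=1$ if $d^k_{T_k}\ge0$ and $\beta_k=\min\{-v^k_i/d^k_i: i\in T_k,\ d^k_i<0\}$ otherwise; let $\tilde z^{k+1}_{T_k}=v^k_{T_k}+\alpha_kd^k_{T_k}$ and $\tilde z^{k+1}_{\overline T_k}=0$. Put $z^{k+1}=\tilde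 z^{k+1}$ if both $$F(v^k)-F(\tilde z^{k+1})\ge c_1\|\tilde z^{k+1}-v^k\|^2\quad\text{and}\quad\|\nabla_{T_k}h(\tilde z^{k+1})\|\le c_2\|\tilde z^{k+1}-v^k\|$$ hold, and $z^{k+1}=v^k$ otherwise. **Theorem.** Let $(z^k)$ be a sequence generated by SGSN. Assume that $(z^k)$ is bounded, that $\nabla f^*$ is semismooth, and that $(z^k)$ has an accumulation point $z^*$ such that, with $S^*=\{i:z^*_i\ne0\}$, $d^\top H_{S^*}d>0$ for all $H\in\widehat\partial^2h(z^*)$ and all $d\in\mathbb R^{|S^*|}\setminus\{0\}$. Then: 1. There are $\varepsilon,\eta_3,\eta_4>0$ such that $$\text{every eigenvalue of }H_{S^*}\text{ lies in }[\eta_3,\eta_4]\quad\text{for all }H\in\widehat\partial^2h(z)\text{ and all }z\text{ with }\|z-z^*\|<\varepsilon.\tag{$*$}$$ 2. Let $\varepsilon,\eta_3,\eta_4>0$ be any numbers satisfying $(*)$. If $c_1\le\eta_3/4$ and $c_2\ge\ell_h+\eta_4+1$, then the whole sequence $(z^k)$ converges to $z^*$ and $$\|z^{k+1}-z^*\|=o(\|z^k-z^*\|)\qquad(k\to\infty).$$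 If moreover $\nabla f^*$ is strongly semismooth, then $\|z^{k+1}-z^*\|=O(\|z^k-z^*\|^2)$. -/

import Mathlib

open Set Filter Topology

namespace SGSN

noncomputable section

/-- Fenchel conjugate `f* y = sup_x (⟪y, x⟫ - f x)`. For a finite strongly convex `f` the supremum is
finite at every `y`, so the real-valued supremum is the usual conjugate. -/
def fenchelConj {n : ℕ} (f : EuclideanSpace ℝ (Fin n) → ℝ) (y : EuclideanSpace ℝ (Fin n)) : ℝ :=
  ⨆ x : EuclideanSpace ℝ (Fin n), (inner ℝ y x - f x)

/-- The gradient map `∇ f*` of the conjugate. -/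
def gradConj {n : ℕ} (f : EuclideanSpace ℝ (Fin n) → ℝ) :
    EuclideanSpace ℝ (Fin n) → EuclideanSpace ℝ (Fin n) :=
  gradient (fenchelConj f)

/-- Jacobian matrix of `Φ` at `x` (meaningful where `Φ` is differentiable). -/
def jacobianMatrix {p q : ℕ} (Φ : EuclideanSpace ℝ (Fin p) → EuclideanSpace ℝ (Fin q))
    (x : EuclideanSpace ℝ (Fin p)) : Matrix (Fin q) (Fin p) ℝ :=
  Matrix.of fun i j => fderiv ℝ Φ x (EuclideanSpace.single j 1) i

/-- Clarke's generalized Jacobian: the convex hull of all limits of Jacobians along sequences of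
differentiability points converging to `x`. -/
def clarkeJacobian {p q : ℕ} (Φ : EuclideanSpace ℝ (Fin p) → EuclideanSpace ℝ (Fin q))
    (x : EuclideanSpace ℝ (Fin p)) : Set (Matrix (Fin q) (Fin p) ℝ) :=
  convexHull ℝ {V | ∃ u : ℕ → EuclideanSpace ℝ (Fin p),
    (∀ k, DifferentiableAt ℝ Φ (u k)) ∧ Tendsto u atTop (𝓝 x) ∧
      Tendsto (fun k => jacobianMatrix Φ (u k)) atTop (𝓝 V)}

/-- All one-sided directional derivatives of `Φ` exist. -/
def DirectionallyDifferentiable {p q : ℕ}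
    (Φ : EuclideanSpace ℝ (Fin p) → EuclideanSpace ℝ (Fin q)) : Prop :=
  ∀ x d : EuclideanSpace ℝ (Fin p), ∃ L : EuclideanSpace ℝ (Fin q),
    Tendsto (fun t : ℝ => t⁻¹ • (Φ (x + t • d) - Φ x)) (𝓝[>] 0) (𝓝 L)

/-- Semismoothness: locally Lipschitz, directionally differentiable, and at every `x`,
`Φ (x + d) - Φ x - H d = o(‖d‖)` uniformly in `H ∈ ∂_C Φ (x + d)`. -/
def Semismooth {p q : ℕ} (Φ : EuclideanSpace ℝ (Fin p) → EuclideanSpace ℝ (Fin q)) : Prop :=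
  LocallyLipschitz Φ ∧ DirectionallyDifferentiable Φ ∧
    ∀ x : EuclideanSpace ℝ (Fin p), ∀ ε : ℝ, 0 < ε → ∃ δ : ℝ, 0 < δ ∧
      ∀ d : EuclideanSpace ℝ (Fin p), ‖d‖ < δ → ∀ H ∈ clarkeJacobian Φ (x + d),
        ‖Φ (x + d) - Φ x - Matrix.toEuclideanLin H d‖ ≤ ε * ‖d‖

/-- Strong semismoothness: the remainder in the semismoothness condition is `O(‖d‖²)`. -/
def StronglySemismooth {p q : ℕ}
    (Φ : EuclideanSpace ℝ (Fin p) → EuclideanSpace ℝ (Fin q)) : Prop :=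
  LocallyLipschitz Φ ∧ DirectionallyDifferentiable Φ ∧
    ∀ x : EuclideanSpace ℝ (Fin p), ∃ C δ : ℝ, 0 < δ ∧
      ∀ d : EuclideanSpace ℝ (Fin p), ‖d‖ < δ → ∀ H ∈ clarkeJacobian Φ (x + d),
        ‖Φ (x + d) - Φ x - Matrix.toEuclideanLin H d‖ ≤ C * ‖d‖ ^ 2

/-- Smooth part of the dual objective: `h z = f*(-Aᵀ z) - ⟪z, b⟫`. -/
def dualSmooth {m n : ℕ} (f : EuclideanSpace ℝ (Fin n) → ℝ) (A : Matrix (Fin m) (Fin n) ℝ)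
    (b : EuclideanSpace ℝ (Fin m)) (z : EuclideanSpace ℝ (Fin m)) : ℝ :=
  fenchelConj f (-(Matrix.toEuclideanLin A.transpose z)) - inner ℝ z b

/-- `ℓ_h = ‖A‖² / σ`, with the Frobenius norm of `A`. -/
def lipConst {m n : ℕ} (A : Matrix (Fin m) (Fin n) ℝ) (σ : ℝ) : ℝ :=
  (∑ i, ∑ j, A i j ^ 2) / σ

/-- Support set of `z`. -/
def supp {m : ℕ} (z : EuclideanSpace ℝ (Fin m)) : Finset (Fin m) :=
  Finset.univ.filter fun i => z i ≠ 0

/-- The function equal to `0` on the nonnegative orthant and `+∞` elsewhere. -/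
def nonnegBarrier {m : ℕ} (z : EuclideanSpace ℝ (Fin m)) : EReal :=
  if ∀ i, 0 ≤ z i then 0 else ⊤

/-- `g z = μ ‖z‖₀ + δ₊(z)`. -/
def sparseReg {m : ℕ} (μ : ℝ) (z : EuclideanSpace ℝ (Fin m)) : EReal :=
  ((μ * ((supp z).card : ℝ) : ℝ) : EReal) + nonnegBarrier z

/-- The dual objective (to be minimized) `F = h + g`, with values in `(-∞, +∞]`. -/
def dualObj {m n : ℕ} (f : EuclideanSpace ℝ (Fin n) → ℝ) (A : Matrix (Fin m) (Fin n) ℝ)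
    (b : EuclideanSpace ℝ (Fin m)) (μ : ℝ) (z : EuclideanSpace ℝ (Fin m)) : EReal :=
  (dualSmooth f A b z : EReal) + sparseReg μ z

/-- The set `{A Q Aᵀ | Q ∈ ∂_C (∇f*)(-Aᵀ z)}` of generalized Hessians of `h` at `z`. -/
def genHessian {m n : ℕ} (f : EuclideanSpace ℝ (Fin n) → ℝ) (A : Matrix (Fin m) (Fin n) ℝ)
    (z : EuclideanSpace ℝ (Fin m)) : Set (Matrix (Fin m) (Fin m) ℝ) :=
  {H | ∃ Q ∈ clarkeJacobian (gradConj f) (-(Matrix.toEuclideanLin A.transpose z)),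
    H = A * Q * A.transpose}

/-- The subvector `x_T`. -/
def subvec {m : ℕ} (T : Finset (Fin m)) (x : EuclideanSpace ℝ (Fin m)) : EuclideanSpace ℝ T :=
  WithLp.toLp 2 fun i : T => x i

/-- The principal submatrix `H_T`. -/
def submat {m : ℕ} (T : Finset (Fin m)) (H : Matrix (Fin m) (Fin m) ℝ) : Matrix T T ℝ :=
  H.submatrix (fun i : T => (i : Fin m)) (fun i : T => (i : Fin m))

/-- Extension by zero of the coordinates in `T`: keeps `x_T` and puts `0` off `T`. -/
def keepOn {m : ℕ} (T : Finset (Fin m)) (x : EuclideanSpace ℝ (Fin m)) :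
    EuclideanSpace ℝ (Fin m) :=
  WithLp.toLp 2 fun i => if i ∈ T then x i else 0

/-- The gradient step `z - τ ∇h(z)`. -/
def gradStep {m n : ℕ} (f : EuclideanSpace ℝ (Fin n) → ℝ) (A : Matrix (Fin m) (Fin n) ℝ)
    (b : EuclideanSpace ℝ (Fin m)) (τ : ℝ) (z : EuclideanSpace ℝ (Fin m)) :
    EuclideanSpace ℝ (Fin m) :=
  z - τ • gradient (dualSmooth f A b) z

/-- The index set `T = {i | [z - τ ∇h(z)]_i > √(2τμ)}`. -/
def activeSet {m n : ℕ} (f : EuclideanSpace ℝ (Fin n) → ℝ) (A : Matrix (Fin m) (Fin n) ℝ)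
    (b : EuclideanSpace ℝ (Fin m)) (μ τ : ℝ) (z : EuclideanSpace ℝ (Fin m)) : Finset (Fin m) :=
  Finset.univ.filter fun i => √(2 * τ * μ) < gradStep f A b τ z i

/-- The proximal gradient iterate `v`: `v_T = [z - τ ∇h(z)]_T`, and `v = 0` off `T`. -/
def proxStep {m n : ℕ} (f : EuclideanSpace ℝ (Fin n) → ℝ) (A : Matrix (Fin m) (Fin n) ℝ)
    (b : EuclideanSpace ℝ (Fin m)) (μ τ : ℝ) (z : EuclideanSpace ℝ (Fin m)) :
    EuclideanSpace ℝ (Fin m) :=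
  keepOn (activeSet f A b μ τ z) (gradStep f A b τ z)

/-- The step length `α = min {1, β}`, where `β = 1` if `d_T ≥ 0` and
`β = min {-v_i / d_i | i ∈ T, d_i < 0}` otherwise. -/
def stepLength {m : ℕ} (T : Finset (Fin m)) (v d : EuclideanSpace ℝ (Fin m)) : ℝ :=
  min 1 (if hN : (T.filter fun i => d i < 0).Nonempty then
    (T.filter fun i => d i < 0).inf' hN fun i => -v i / d i else 1)

/-- The Newton iterate: `v_T + α d_T` on `T`, and `0` off `T`. -/
def newtonStep {m : ℕ} (T : Finset (Fin m)) (v d : EuclideanSpace ℝ (Fin m)) :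
    EuclideanSpace ℝ (Fin m) :=
  keepOn T (v + stepLength T v d • d)

/-- The regularized Newton equation `(H_T + γ ‖∇_T h(v)‖ I) d_T = -∇_T h(v)`. -/
def NewtonEq {m n : ℕ} (f : EuclideanSpace ℝ (Fin n) → ℝ) (A : Matrix (Fin m) (Fin n) ℝ)
    (b : EuclideanSpace ℝ (Fin m)) (γ : ℝ) (T : Finset (Fin m)) (H : Matrix (Fin m) (Fin m) ℝ)
    (v d : EuclideanSpace ℝ (Fin m)) : Prop :=
  Matrix.toEuclideanLin
      (submat T H + (γ * ‖subvec T (gradient (dualSmooth f A b) v)‖) • (1 : Matrix T T ℝ))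
      (subvec T d) =
    -subvec T (gradient (dualSmooth f A b) v)

/-- The two acceptance conditions for a Newton iterate `w`:
`F(v) - F(w) ≥ c₁ ‖w - v‖²` and `‖∇_T h(w)‖ ≤ c₂ ‖w - v‖`. -/
def Accepted {m n : ℕ} (f : EuclideanSpace ℝ (Fin n) → ℝ) (A : Matrix (Fin m) (Fin n) ℝ)
    (b : EuclideanSpace ℝ (Fin m)) (μ c₁ c₂ : ℝ) (T : Finset (Fin m))
    (v w : EuclideanSpace ℝ (Fin m)) : Prop :=
  dualObj f A b μ w + ((c₁ * ‖w - v‖ ^ 2 : ℝ) : EReal) ≤ dualObj f A b μ v ∧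
    ‖subvec T (gradient (dualSmooth f A b) w)‖ ≤ c₂ * ‖w - v‖

/-- One iteration of the method leads from `z` to `z'`, for some choice of the generalized Hessian
`H` and some solution `d` of the Newton equation. -/
def Step {m n : ℕ} (f : EuclideanSpace ℝ (Fin n) → ℝ) (A : Matrix (Fin m) (Fin n) ℝ)
    (b : EuclideanSpace ℝ (Fin m)) (μ τ c₁ c₂ γ : ℝ) (z z' : EuclideanSpace ℝ (Fin m)) : Prop :=
  let T := activeSet f A b μ τ z
  let v := proxStep f A b μ τ z
  ∃ H ∈ genHessian f A v, ∃ d : EuclideanSpace ℝ (Fin m), NewtonEq f A b γ T H v d ∧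
    (Accepted f A b μ c₁ c₂ T v (newtonStep T v d) → z' = newtonStep T v d) ∧
    (¬ Accepted f A b μ c₁ c₂ T v (newtonStep T v d) → z' = v)

/-- `z` is a sequence of iterates of the subspace gradient semismooth Newton method. -/
def IsSequence {m n : ℕ} (f : EuclideanSpace ℝ (Fin n) → ℝ) (A : Matrix (Fin m) (Fin n) ℝ)
    (b : EuclideanSpace ℝ (Fin m)) (μ τ c₁ c₂ γ : ℝ) (z : ℕ → EuclideanSpace ℝ (Fin m)) : Prop :=
  ∀ k, Step f A b μ τ c₁ c₂ γ (z k) (z (k + 1))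

/-- Second-order sufficient condition: `dᵀ H_S d > 0` for every `H` in the set of generalized
Hessians at `zs` and every nonzero `d`, where `S` is the support of `zs`. -/
def SOSC {m n : ℕ} (f : EuclideanSpace ℝ (Fin n) → ℝ) (A : Matrix (Fin m) (Fin n) ℝ)
    (zs : EuclideanSpace ℝ (Fin m)) : Prop :=
  ∀ H ∈ genHessian f A zs, ∀ d : supp zs → ℝ, d ≠ 0 →
    0 < dotProduct d ((submat (supp zs) H).mulVec d)

/-- `η₃` and `η₄` are positive lower and upper bounds for all eigenvalues of `H_S`, where `S` is the
support of `zs` and `H` runs over the generalized Hessians at the points of the open ball of radius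
`ε > 0` around `zs`. -/
def EigenvalueBounds {m n : ℕ} (f : EuclideanSpace ℝ (Fin n) → ℝ) (A : Matrix (Fin m) (Fin n) ℝ)
    (zs : EuclideanSpace ℝ (Fin m)) (ε η₃ η₄ : ℝ) : Prop :=
  0 < ε ∧ 0 < η₃ ∧ 0 < η₄ ∧
    ∀ z ∈ Metric.ball zs ε, ∀ H ∈ genHessian f A z, ∀ l ∈ spectrum ℝ (submat (supp zs) H),
      η₃ ≤ l ∧ l ≤ η₄

end

end SGSN

/-!
Strong convexity makes `f*` differentiable with `1 / σ`-Lipschitz gradient, so `∇h` is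
`ℓ_h`-Lipschitz, and the proximal gradient step `z ↦ v`, which minimizes a quadratic model of `F`
coordinatewise, decreases `F` by a multiple of `‖v - z‖²`; an accepted Newton step does not increase
`F` again. Along the iterates `F` is bounded below by its behaviour at the accumulation point `z*`,
so `vᵏ - zᵏ → 0`. Hence `z*` is stationary, and as the nonzero entries of `vᵏ` exceed `√(2τμ)`, the
support of `vᵏ` is that of `z*` as soon as `vᵏ` is close to `z*`.

On the coordinate subspace of this support the method is a regularized semismooth Newton method for
`h`. The generalized Hessians are uniformly coercive there, and the regularization perturbs the step
by only `O(‖v - z*‖²)` because `‖∇h(v)‖ = O(‖v - z*‖)` on the support, so the full Newton step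
lands at a distance `o(‖v - z*‖)` from `z*`. Such a point is positive on the support, which makes
the step length `1`, and it passes both acceptance tests because `h` grows quadratically at `z*`
along the subspace. Therefore the method contracts near `z*`, and the accumulation point attracts
the whole sequence.
-/

namespace SGSN

section StrongConvexity

variable {E : Type*} [NormedAddCommGroup E] [NormedSpace ℝ E] {g : E → ℝ} {σ : ℝ}

theorem continuous_of_strongConvexOn [FiniteDimensional ℝ E] (hσ : 0 ≤ σ)
    (hg : StrongConvexOn univ σ g) : Continuous g :=
  have hconv : ConvexOn ℝ univ g := UniformConvexOn.convexOn hg fun r => by positivity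
  continuousOn_univ.1 (hconv.continuousOn isOpen_univ)

theorem le_of_strongConvexOn_of_le_unitBall {C : ℝ} (hg : StrongConvexOn univ σ g)
    (hC : ∀ x ∈ Metric.closedBall (0 : E) 1, C ≤ g x) {x : E} (hx : 1 ≤ ‖x‖) :
    g 0 + ‖x‖ * (C - g 0 + σ / 2 * (‖x‖ - 1)) ≤ g x := by
  have hx₀ : 0 < ‖x‖ := one_pos.trans_le hx
  have hball : C ≤ g (‖x‖⁻¹ • x + (1 - ‖x‖⁻¹) • (0 : E)) :=
    hC _ (by simp [norm_smul, inv_mul_cancel₀ hx₀.ne'])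
  have hconv := hball.trans <| hg.2 (mem_univ x) (mem_univ 0) (inv_nonneg.2 hx₀.le)
    (sub_nonneg.2 (inv_le_one_of_one_le₀ hx)) (by ring)
  calc g 0 + ‖x‖ * (C - g 0 + σ / 2 * (‖x‖ - 1))
      ≤ g 0 + ‖x‖ * (‖x‖⁻¹ • g x + (1 - ‖x‖⁻¹) • g 0
          - ‖x‖⁻¹ * (1 - ‖x‖⁻¹) * (σ / 2 * ‖x - 0‖ ^ 2) - g 0 + σ / 2 * (‖x‖ - 1)) := by
        gcongr
    _ = g x := by
        simp only [smul_eq_mul, sub_zero]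
        field_simp
        ring

theorem tendsto_cocompact_atTop_of_strongConvexOn [FiniteDimensional ℝ E] (hσ : 0 < σ)
    (hg : StrongConvexOn univ σ g) : Tendsto g (cocompact E) atTop := by
  obtain ⟨C, hC⟩ := (isCompact_closedBall (0 : E) 1).bddBelow_image
    (continuous_of_strongConvexOn hσ.le hg).continuousOn
  have hC' : ∀ x ∈ Metric.closedBall (0 : E) 1, C ≤ g x := fun x hx => hC (mem_image_of_mem g hx)
  have hquad : Tendsto (fun r : ℝ => g 0 + r * (C - g 0 + σ / 2 * (r - 1))) atTop atTop :=
    tendsto_const_nhds.add_atTop <| tendsto_id.atTop_mul_atTop₀ <| tendsto_const_nhds.add_atTop <|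
      (tendsto_atTop_add_const_right _ (-1 : ℝ) tendsto_id).const_mul_atTop (half_pos hσ)
  have hnorm := tendsto_norm_cocompact_atTop (E := E)
  refine tendsto_atTop_mono' _ ?_ (hquad.comp hnorm)
  filter_upwards [hnorm.eventually_ge_atTop 1] with x hx
  exact le_of_strongConvexOn_of_le_unitBall hg hC' hx

theorem exists_isMinOn_of_strongConvexOn [FiniteDimensional ℝ E] (hσ : 0 < σ)
    (hg : StrongConvexOn univ σ g) : ∃ x₀, IsMinOn g univ x₀ := by
  obtain ⟨x₀, hx₀⟩ := (continuous_of_strongConvexOn hσ.le hg).exists_forall_le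
    (tendsto_cocompact_atTop_of_strongConvexOn hσ hg)
  exact ⟨x₀, fun x _ => hx₀ x⟩

theorem quadratic_growth_of_strongConvexOn (hg : StrongConvexOn univ σ g) {x₀ : E}
    (hx₀ : IsMinOn g univ x₀) (x : E) : g x₀ + σ / 2 * ‖x - x₀‖ ^ 2 ≤ g x := by
  have hlim : Tendsto (fun t : ℝ => g x₀ + (1 - t) * (σ / 2 * ‖x - x₀‖ ^ 2)) (𝓝[>] 0)
      (𝓝 (g x₀ + (1 - 0) * (σ / 2 * ‖x - x₀‖ ^ 2))) :=
    Continuous.continuousWithinAt (f := fun t : ℝ => g x₀ + (1 - t) * (σ / 2 * ‖x - x₀‖ ^ 2))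
      (by fun_prop)
  rw [sub_zero, one_mul] at hlim
  refine le_of_tendsto hlim ?_
  filter_upwards [Ioo_mem_nhdsGT (zero_lt_one' ℝ)] with t ht
  have hseg := (hx₀ (mem_univ _)).trans
    (hg.2 (mem_univ x) (mem_univ x₀) ht.1.le (sub_nonneg.2 ht.2.le) (by ring))
  simp only [smul_eq_mul] at hseg
  exact le_of_mul_le_mul_left (by linarith) ht.1

end StrongConvexity

section Conjugate

theorem strongConvexOn_sub_inner {E : Type*} [NormedAddCommGroup E] [InnerProductSpace ℝ E]
    {f : E → ℝ} {σ : ℝ} (hf : StrongConvexOn univ σ f) (y : E) :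
    StrongConvexOn univ σ fun x => f x - inner ℝ y x := by
  refine ⟨convex_univ, fun x _ x' _ a b ha hb hab => ?_⟩
  have := hf.2 (mem_univ x) (mem_univ x') ha hb hab
  simp only [inner_add_right, inner_smul_right, smul_eq_mul] at *
  linarith

theorem hasGradientAt_of_abs_sub_le {E : Type*} [NormedAddCommGroup E] [InnerProductSpace ℝ E]
    [CompleteSpace E] {φ : E → ℝ} {g y : E} {L : ℝ}
    (h : ∀ y', |φ y' - φ y - inner ℝ g (y' - y)| ≤ L * ‖y' - y‖ ^ 2) : HasGradientAt φ g y := by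
  rw [hasGradientAt_iff_isLittleO]
  have hquad : (fun y' => φ y' - φ y - inner ℝ g (y' - y)) =O[𝓝 y] fun y' => ‖y' - y‖ ^ 2 :=
    Asymptotics.IsBigO.of_bound L (Eventually.of_forall fun y' => by simpa using h y')
  have hsub : Tendsto (fun y' => y' - y) (𝓝 y) (𝓝 0) := by
    simpa using (tendsto_id (α := E) (x := 𝓝 y)).sub_const y
  exact hquad.trans_isLittleO <|
    (Asymptotics.isLittleO_norm_pow_id one_lt_two).comp_tendsto hsub

variable {n : ℕ} {f : EuclideanSpace ℝ (Fin n) → ℝ} {σ : ℝ} {x₀ y : EuclideanSpace ℝ (Fin n)}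

theorem fenchelConj_eq_of_isMinOn (hx₀ : IsMinOn (fun x => f x - inner ℝ y x) univ x₀) :
    fenchelConj f y = inner ℝ y x₀ - f x₀ := by
  have hle : ∀ x, inner ℝ y x - f x ≤ inner ℝ y x₀ - f x₀ := fun x => by
    have : f x₀ - inner ℝ y x₀ ≤ f x - inner ℝ y x := hx₀ (mem_univ x)
    linarith
  exact le_antisymm (ciSup_le hle) (le_ciSup (f := fun x => inner ℝ y x - f x)
    ⟨_, by rintro _ ⟨x, rfl⟩; exact hle x⟩ x₀)

theorem exists_isMinOn_sub_inner (hσ : 0 < σ) (hf : StrongConvexOn univ σ f)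
    (y : EuclideanSpace ℝ (Fin n)) : ∃ x₀, IsMinOn (fun x => f x - inner ℝ y x) univ x₀ :=
  exists_isMinOn_of_strongConvexOn hσ (strongConvexOn_sub_inner hf y)

theorem fenchelConj_add_inner_le (hσ : 0 < σ) (hf : StrongConvexOn univ σ f)
    (hx₀ : IsMinOn (fun x => f x - inner ℝ y x) univ x₀) (y' : EuclideanSpace ℝ (Fin n)) :
    fenchelConj f y + inner ℝ x₀ (y' - y) ≤ fenchelConj f y' := by
  obtain ⟨x₁, hx₁⟩ := exists_isMinOn_sub_inner hσ hf y'
  have : f x₁ - inner ℝ y' x₁ ≤ f x₀ - inner ℝ y' x₀ := hx₁ (mem_univ x₀)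
  rw [fenchelConj_eq_of_isMinOn hx₀, fenchelConj_eq_of_isMinOn hx₁, inner_sub_right,
    real_inner_comm y', real_inner_comm y]
  linarith

theorem fenchelConj_le_of_isMinOn (hσ : 0 < σ) (hf : StrongConvexOn univ σ f)
    (hx₀ : IsMinOn (fun x => f x - inner ℝ y x) univ x₀) (y' : EuclideanSpace ℝ (Fin n)) :
    fenchelConj f y' ≤
      fenchelConj f y + inner ℝ x₀ (y' - y) + 1 / (2 * σ) * ‖y' - y‖ ^ 2 := by
  obtain ⟨x₁, hx₁⟩ := exists_isMinOn_sub_inner hσ hf y'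
  have hgrowth := quadratic_growth_of_strongConvexOn (strongConvexOn_sub_inner hf y) hx₀ x₁
  have hyoung : inner ℝ (y' - y) (x₁ - x₀) ≤
      1 / (2 * σ) * ‖y' - y‖ ^ 2 + σ / 2 * ‖x₁ - x₀‖ ^ 2 := by
    have hsq : 0 ≤ 1 / (2 * σ) * (‖y' - y‖ - σ * ‖x₁ - x₀‖) ^ 2 := by positivity
    calc inner ℝ (y' - y) (x₁ - x₀) ≤ ‖y' - y‖ * ‖x₁ - x₀‖ := real_inner_le_norm _ _
      _ ≤ ‖y' - y‖ * ‖x₁ - x₀‖ + 1 / (2 * σ) * (‖y' - y‖ - σ * ‖x₁ - x₀‖) ^ 2 := by linarith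
      _ = _ := by field_simp; ring
  rw [fenchelConj_eq_of_isMinOn hx₀, fenchelConj_eq_of_isMinOn hx₁]
  simp only [inner_sub_left, inner_sub_right, real_inner_comm y' x₀, real_inner_comm y x₀] at *
  linarith

theorem hasGradientAt_fenchelConj_of_isMinOn (hσ : 0 < σ) (hf : StrongConvexOn univ σ f)
    (hx₀ : IsMinOn (fun x => f x - inner ℝ y x) univ x₀) :
    HasGradientAt (fenchelConj f) x₀ y := by
  refine hasGradientAt_of_abs_sub_le (L := 1 / (2 * σ)) fun y' => ?_
  have hlower := fenchelConj_add_inner_le hσ hf hx₀ y'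
  have hupper := fenchelConj_le_of_isMinOn hσ hf hx₀ y'
  have : 0 ≤ 1 / (2 * σ) * ‖y' - y‖ ^ 2 := by positivity
  exact abs_le.2 ⟨by linarith, by linarith⟩

theorem isMinOn_gradConj (hσ : 0 < σ) (hf : StrongConvexOn univ σ f)
    (y : EuclideanSpace ℝ (Fin n)) :
    IsMinOn (fun x => f x - inner ℝ y x) univ (gradConj f y) := by
  obtain ⟨x₀, hx₀⟩ := exists_isMinOn_sub_inner hσ hf y
  rwa [gradConj, (hasGradientAt_fenchelConj_of_isMinOn hσ hf hx₀).gradient]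

theorem hasGradientAt_fenchelConj (hσ : 0 < σ) (hf : StrongConvexOn univ σ f)
    (y : EuclideanSpace ℝ (Fin n)) : HasGradientAt (fenchelConj f) (gradConj f y) y :=
  hasGradientAt_fenchelConj_of_isMinOn hσ hf (isMinOn_gradConj hσ hf y)

theorem norm_gradConj_sub_le (hσ : 0 < σ) (hf : StrongConvexOn univ σ f)
    (y y' : EuclideanSpace ℝ (Fin n)) :
    ‖gradConj f y - gradConj f y'‖ ≤ 1 / σ * ‖y - y'‖ := by
  set x := gradConj f y
  set x' := gradConj f y'
  have hmono : σ * ‖x - x'‖ ^ 2 ≤ inner ℝ (y - y') (x - x') := by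
    have hx := quadratic_growth_of_strongConvexOn (strongConvexOn_sub_inner hf y)
      (isMinOn_gradConj hσ hf y) x'
    have hx' := quadratic_growth_of_strongConvexOn (strongConvexOn_sub_inner hf y')
      (isMinOn_gradConj hσ hf y') x
    rw [norm_sub_rev] at hx
    simp only [inner_sub_left, inner_sub_right]
    linarith
  rw [one_div_mul_eq_div, le_div_iff₀ hσ]
  rcases (norm_nonneg (x - x')).eq_or_lt with h₀ | hpos
  · simp [← h₀]
  · refine le_of_mul_le_mul_right ?_ hpos
    calc ‖x - x'‖ * σ * ‖x - x'‖ = σ * ‖x - x'‖ ^ 2 := by ring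
      _ ≤ ‖y - y'‖ * ‖x - x'‖ := hmono.trans (real_inner_le_norm _ _)

theorem lipschitzWith_gradConj (hσ : 0 < σ) (hf : StrongConvexOn univ σ f) :
    LipschitzWith (1 / σ).toNNReal (gradConj f) :=
  LipschitzWith.of_dist_le_mul fun y y' => by
    rw [dist_eq_norm, dist_eq_norm, Real.coe_toNNReal _ (by positivity)]
    exact norm_gradConj_sub_le hσ hf y y'

end Conjugate

section Frobenius

open scoped Matrix.Norms.Frobenius

variable {ι κ : Type*} [Fintype ι] [Fintype κ] [DecidableEq κ]

theorem norm_toEuclideanLin_le (A : Matrix ι κ ℝ) (x : EuclideanSpace ℝ κ) :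
    ‖Matrix.toEuclideanLin A x‖ ≤ ‖A‖ * ‖x‖ := by
  have h := Matrix.frobenius_norm_mul A (Matrix.replicateCol Unit x.ofLp)
  rwa [← Matrix.replicateCol_mulVec, Matrix.frobenius_norm_replicateCol,
    Matrix.frobenius_norm_replicateCol] at h

theorem lipConst_eq_norm_sq_div {m n : ℕ} (A : Matrix (Fin m) (Fin n) ℝ) (σ : ℝ) :
    lipConst A σ = ‖A‖ ^ 2 / σ := by
  rw [lipConst, Matrix.frobenius_norm_def, ← Real.sqrt_eq_rpow,
    Real.sq_sqrt (by positivity)]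
  simp

theorem lipConst_nonneg {m n : ℕ} {σ : ℝ} (hσ : 0 < σ) (A : Matrix (Fin m) (Fin n) ℝ) :
    0 ≤ lipConst A σ := by
  rw [lipConst_eq_norm_sq_div]
  positivity

variable {m n : ℕ}

/-- The linear map `z ↦ -Aᵀ z`, through which `h = f* ∘ (-Aᵀ) - ⟪·, b⟫` depends on the conjugate
of `f`. -/
noncomputable def negTranspose (A : Matrix (Fin m) (Fin n) ℝ) :
    EuclideanSpace ℝ (Fin m) →ₗ[ℝ] EuclideanSpace ℝ (Fin n) :=
  -Matrix.toEuclideanLin A.transpose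

theorem inner_negTranspose (A : Matrix (Fin m) (Fin n) ℝ) (x : EuclideanSpace ℝ (Fin n))
    (z : EuclideanSpace ℝ (Fin m)) :
    inner ℝ x (negTranspose A z) = -inner ℝ (Matrix.toEuclideanLin A x) z := by
  rw [negTranspose, LinearMap.neg_apply, inner_neg_right,
    ← Matrix.conjTranspose_eq_transpose_of_trivial, Matrix.toEuclideanLin_conjTranspose_eq_adjoint,
    LinearMap.adjoint_inner_right]

theorem norm_negTranspose_le (A : Matrix (Fin m) (Fin n) ℝ) (z : EuclideanSpace ℝ (Fin m)) :
    ‖negTranspose A z‖ ≤ ‖A‖ * ‖z‖ := by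
  rw [negTranspose, LinearMap.neg_apply, norm_neg, ← Matrix.frobenius_norm_transpose A]
  exact norm_toEuclideanLin_le _ _

theorem continuous_negTranspose (A : Matrix (Fin m) (Fin n) ℝ) : Continuous (negTranspose A) :=
  (negTranspose A).continuous_of_finiteDimensional

theorem toEuclideanLin_mul_mul_transpose (A : Matrix (Fin m) (Fin n) ℝ)
    (Q : Matrix (Fin n) (Fin n) ℝ) (z : EuclideanSpace ℝ (Fin m)) :
    Matrix.toEuclideanLin (A * Q * A.transpose) z =
      -Matrix.toEuclideanLin A (Matrix.toEuclideanLin Q (negTranspose A z)) := by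
  ext i
  simp [negTranspose, Matrix.mulVec_mulVec, Matrix.mul_assoc]

end Frobenius

section CoordSubspace

variable {m : ℕ} {S : Finset (Fin m)} {x y : EuclideanSpace ℝ (Fin m)}

/-- The vectors supported in `S`. The subvectors `x_S` and principal submatrices `H_S` of the method
are handled through this subspace of the ambient space. -/
def coordSubspace (S : Finset (Fin m)) : Submodule ℝ (EuclideanSpace ℝ (Fin m)) where
  carrier := {x | ∀ i ∉ S, x i = 0}
  zero_mem' := fun _ _ => rfl
  add_mem' := fun hx hy i hi => by simp [hx i hi, hy i hi]
  smul_mem' := fun c x hx i hi => by simp [hx i hi]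

theorem mem_coordSubspace_supp (x : EuclideanSpace ℝ (Fin m)) : x ∈ coordSubspace (supp x) :=
  fun i hi => by simpa [supp] using hi

theorem keepOn_mem_coordSubspace (S : Finset (Fin m)) (x : EuclideanSpace ℝ (Fin m)) :
    keepOn S x ∈ coordSubspace S :=
  fun i hi => by simp [keepOn, hi]

theorem subvec_keepOn (S : Finset (Fin m)) (x : EuclideanSpace ℝ (Fin m)) :
    subvec S (keepOn S x) = subvec S x := by
  ext i
  simp [subvec, keepOn]

theorem exists_mem_coordSubspace_subvec_eq (d : EuclideanSpace ℝ S) :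
    ∃ x ∈ coordSubspace S, subvec S x = d :=
  ⟨WithLp.toLp 2 fun i => if h : i ∈ S then d ⟨i, h⟩ else 0,
    fun i hi => by simp [hi], by ext i; simp [subvec]⟩

theorem inner_subvec (hx : x ∈ coordSubspace S) (y : EuclideanSpace ℝ (Fin m)) :
    inner ℝ (subvec S x) (subvec S y) = inner ℝ x y := by
  simp only [PiLp.inner_apply, subvec]
  rw [Finset.sum_coe_sort S fun i => inner ℝ (x i) (y i)]
  exact Finset.sum_subset (Finset.subset_univ S) fun i _ hi => by simp [hx i hi]

theorem norm_subvec (hx : x ∈ coordSubspace S) : ‖subvec S x‖ = ‖x‖ := by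
  rw [norm_eq_sqrt_real_inner, inner_subvec hx, ← norm_eq_sqrt_real_inner]

theorem norm_subvec_le (S : Finset (Fin m)) (x : EuclideanSpace ℝ (Fin m)) :
    ‖subvec S x‖ ≤ ‖x‖ := by
  rw [EuclideanSpace.norm_eq, EuclideanSpace.norm_eq]
  gcongr
  simp only [subvec]
  rw [Finset.sum_coe_sort S fun i => ‖x i‖ ^ 2]
  exact Finset.sum_le_univ_sum_of_nonneg fun i => by positivity

theorem norm_keepOn_le (S : Finset (Fin m)) (x : EuclideanSpace ℝ (Fin m)) :
    ‖keepOn S x‖ ≤ ‖x‖ := by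
  rw [← norm_subvec (keepOn_mem_coordSubspace S x), subvec_keepOn]
  exact norm_subvec_le S x

theorem toEuclideanLin_submat_subvec (H : Matrix (Fin m) (Fin m) ℝ) (hy : y ∈ coordSubspace S) :
    Matrix.toEuclideanLin (submat S H) (subvec S y) = subvec S (Matrix.toEuclideanLin H y) := by
  ext i
  simp only [subvec, submat, Matrix.ofLp_toLpLin, Matrix.toLin'_apply, Matrix.mulVec, dotProduct,
    Matrix.submatrix_apply]
  rw [Finset.sum_coe_sort S fun j => H i j * y j]
  exact Finset.sum_subset (Finset.subset_univ S) fun j _ hj => by simp [hy j hj]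

theorem inner_subvec_submat (H : Matrix (Fin m) (Fin m) ℝ) (hx : x ∈ coordSubspace S)
    (hy : y ∈ coordSubspace S) :
    inner ℝ (subvec S x) (Matrix.toEuclideanLin (submat S H) (subvec S y)) =
      inner ℝ x (Matrix.toEuclideanLin H y) := by
  rw [toEuclideanLin_submat_subvec H hy, inner_subvec hx]

end CoordSubspace

section DualSmooth

open scoped Matrix.Norms.Frobenius

variable {m n : ℕ} {f : EuclideanSpace ℝ (Fin n) → ℝ} {σ : ℝ} {A : Matrix (Fin m) (Fin n) ℝ}
  {b : EuclideanSpace ℝ (Fin m)}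

theorem hasGradientAt_dualSmooth (hσ : 0 < σ) (hf : StrongConvexOn univ σ f)
    (z : EuclideanSpace ℝ (Fin m)) :
    HasGradientAt (dualSmooth f A b)
      (-Matrix.toEuclideanLin A (gradConj f (negTranspose A z)) - b) z := by
  have hconj := (hasGradientAt_fenchelConj hσ hf (negTranspose A z)).hasFDerivAt.comp z
    (negTranspose A).toContinuousLinearMap.hasFDerivAt
  have hlin : HasFDerivAt (fun w => inner ℝ w b) (InnerProductSpace.toDual ℝ _ b) z := by
    simp only [real_inner_comm b]
    exact (InnerProductSpace.toDual ℝ _ b).hasFDerivAt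
  refine hasGradientAt_iff_hasFDerivAt.2 ((hconj.sub hlin).congr_fderiv ?_)
  ext w
  simp [inner_negTranspose]

theorem gradient_dualSmooth_sub (hσ : 0 < σ) (hf : StrongConvexOn univ σ f)
    (z z' : EuclideanSpace ℝ (Fin m)) :
    gradient (dualSmooth f A b) z - gradient (dualSmooth f A b) z' =
      -Matrix.toEuclideanLin A
        (gradConj f (negTranspose A z) - gradConj f (negTranspose A z')) := by
  rw [(hasGradientAt_dualSmooth hσ hf z).gradient, (hasGradientAt_dualSmooth hσ hf z').gradient,
    map_sub]
  abel

theorem norm_gradient_dualSmooth_sub_le (hσ : 0 < σ) (hf : StrongConvexOn univ σ f)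
    (z z' : EuclideanSpace ℝ (Fin m)) :
    ‖gradient (dualSmooth f A b) z - gradient (dualSmooth f A b) z'‖ ≤
      lipConst A σ * ‖z - z'‖ := by
  rw [gradient_dualSmooth_sub hσ hf, norm_neg, lipConst_eq_norm_sq_div]
  calc _ ≤ ‖A‖ * ‖gradConj f (negTranspose A z) - gradConj f (negTranspose A z')‖ :=
        norm_toEuclideanLin_le _ _
    _ ≤ ‖A‖ * (1 / σ * ‖negTranspose A (z - z')‖) := by
        rw [map_sub]
        gcongr
        exact norm_gradConj_sub_le hσ hf _ _
    _ ≤ ‖A‖ * (1 / σ * (‖A‖ * ‖z - z'‖)) := by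
        gcongr
        exact norm_negTranspose_le A _
    _ = ‖A‖ ^ 2 / σ * ‖z - z'‖ := by ring

theorem continuous_gradient_dualSmooth (hσ : 0 < σ) (hf : StrongConvexOn univ σ f) :
    Continuous (gradient (dualSmooth f A b)) :=
  LipschitzWith.continuous (K := (lipConst A σ).toNNReal) <|
    LipschitzWith.of_dist_le_mul fun z z' => by
      rw [dist_eq_norm, dist_eq_norm, Real.coe_toNNReal _ (lipConst_nonneg hσ A)]
      exact norm_gradient_dualSmooth_sub_le hσ hf z z'

theorem hasGradientAt_gradient_dualSmooth (hσ : 0 < σ) (hf : StrongConvexOn univ σ f)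
    (z : EuclideanSpace ℝ (Fin m)) :
    HasGradientAt (dualSmooth f A b) (gradient (dualSmooth f A b) z) z :=
  (hasGradientAt_dualSmooth hσ hf z).differentiableAt.hasGradientAt

theorem continuous_dualSmooth (hσ : 0 < σ) (hf : StrongConvexOn univ σ f) :
    Continuous (dualSmooth f A b) :=
  continuous_iff_continuousAt.2 fun z => (hasGradientAt_dualSmooth hσ hf z).continuousAt

theorem dualSmooth_le (hσ : 0 < σ) (hf : StrongConvexOn univ σ f)
    (z z' : EuclideanSpace ℝ (Fin m)) :
    dualSmooth f A b z' ≤ dualSmooth f A b z + inner ℝ (gradient (dualSmooth f A b) z) (z' - z) +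
      lipConst A σ / 2 * ‖z' - z‖ ^ 2 := by
  have hconj := fenchelConj_le_of_isMinOn hσ hf (isMinOn_gradConj hσ hf (negTranspose A z))
    (negTranspose A z')
  rw [← map_sub, inner_negTranspose] at hconj
  have hnorm : 1 / (2 * σ) * ‖negTranspose A (z' - z)‖ ^ 2 ≤
      lipConst A σ / 2 * ‖z' - z‖ ^ 2 := by
    calc _ ≤ 1 / (2 * σ) * (‖A‖ * ‖z' - z‖) ^ 2 := by
          gcongr
          exact norm_negTranspose_le A _
      _ = _ := by rw [lipConst_eq_norm_sq_div]; field_simp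
  rw [(hasGradientAt_dualSmooth hσ hf z).gradient, inner_sub_left, inner_neg_left,
    inner_sub_right b, real_inner_comm z' b, real_inner_comm z b]
  change fenchelConj f (negTranspose A z') - inner ℝ z' b ≤
    fenchelConj f (negTranspose A z) - inner ℝ z b + _ + _
  linarith

end DualSmooth

section ClarkeJacobian

variable {p q : ℕ} {Φ : EuclideanSpace ℝ (Fin p) → EuclideanSpace ℝ (Fin q)} {K : NNReal}

theorem toEuclideanLin_jacobianMatrix (x d : EuclideanSpace ℝ (Fin p)) :
    Matrix.toEuclideanLin (jacobianMatrix Φ x) d = fderiv ℝ Φ x d := by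
  have h : Matrix.toEuclideanLin (jacobianMatrix Φ x) = (fderiv ℝ Φ x).toLinearMap := by
    refine (EuclideanSpace.basisFun (Fin p) ℝ).toBasis.ext fun j => ?_
    ext i
    simp [jacobianMatrix]
  exact congrArg (fun L => L d) h

theorem norm_toEuclideanLin_jacobianMatrix_le (hΦ : LipschitzWith K Φ)
    (x d : EuclideanSpace ℝ (Fin p)) :
    ‖Matrix.toEuclideanLin (jacobianMatrix Φ x) d‖ ≤ K * ‖d‖ := by
  rw [toEuclideanLin_jacobianMatrix]
  exact (fderiv ℝ Φ x).le_of_opNorm_le (norm_fderiv_le_of_lipschitz ℝ hΦ) d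

theorem abs_jacobianMatrix_apply_le (hΦ : LipschitzWith K Φ) (x : EuclideanSpace ℝ (Fin p))
    (i : Fin q) (j : Fin p) : |jacobianMatrix Φ x i j| ≤ K := by
  calc |fderiv ℝ Φ x (EuclideanSpace.single j 1) i|
      ≤ ‖fderiv ℝ Φ x (EuclideanSpace.single j 1)‖ := by
        rw [← Real.norm_eq_abs]
        exact PiLp.norm_apply_le _ i
    _ ≤ K * ‖EuclideanSpace.single j (1 : ℝ)‖ :=
        (fderiv ℝ Φ x).le_of_opNorm_le (norm_fderiv_le_of_lipschitz ℝ hΦ) _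
    _ = K := by simp

theorem exists_subseq_tendsto_mem_clarkeJacobian (hΦ : LipschitzWith K Φ)
    {x : EuclideanSpace ℝ (Fin p)} {u : ℕ → EuclideanSpace ℝ (Fin p)}
    (hu : ∀ k, DifferentiableAt ℝ Φ (u k)) (hux : Tendsto u atTop (𝓝 x)) :
    ∃ V ∈ clarkeJacobian Φ x, ∃ φ : ℕ → ℕ, StrictMono φ ∧
      Tendsto (fun k => jacobianMatrix Φ (u (φ k))) atTop (𝓝 V) := by
  have hmem : ∀ k, (jacobianMatrix Φ (u k) : Fin q → Fin p → ℝ) ∈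
      Set.pi univ fun _ : Fin q => Set.pi univ fun _ : Fin p => Icc (-(K : ℝ)) K :=
    fun k i _ j _ => abs_le.1 (abs_jacobianMatrix_apply_le hΦ (u k) i j)
  obtain ⟨V, -, φ, hφ, hV⟩ := (isCompact_univ_pi fun _ : Fin q =>
    isCompact_univ_pi fun _ : Fin p => isCompact_Icc).tendsto_subseq hmem
  exact ⟨V, subset_convexHull ℝ _ ⟨u ∘ φ, fun k => hu _, hux.comp hφ.tendsto_atTop, hV⟩, φ, hφ, hV⟩

theorem clarkeJacobian_nonempty (hΦ : LipschitzWith K Φ) (x : EuclideanSpace ℝ (Fin p)) :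
    (clarkeJacobian Φ x).Nonempty := by
  have hrademacher : Dense {y | DifferentiableAt ℝ Φ y} :=
    MeasureTheory.Measure.dense_of_ae (μ := MeasureTheory.volume) hΦ.ae_differentiableAt
  obtain ⟨u, hu, hux⟩ := mem_closure_iff_seq_limit.1 (hrademacher x)
  obtain ⟨V, hV, -⟩ := exists_subseq_tendsto_mem_clarkeJacobian hΦ hu hux
  exact ⟨V, hV⟩

theorem clarkeJacobian_subset {C : Set (Matrix (Fin q) (Fin p) ℝ)} (hconv : Convex ℝ C)
    (hclosed : IsClosed C) {x : EuclideanSpace ℝ (Fin p)}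
    (h : ∀ᶠ y in 𝓝 x, DifferentiableAt ℝ Φ y → jacobianMatrix Φ y ∈ C) :
    clarkeJacobian Φ x ⊆ C := by
  refine convexHull_min ?_ hconv
  rintro V ⟨u, hu, hux, hV⟩
  exact hclosed.mem_of_tendsto hV ((hux.eventually h).mono fun k hk => hk (hu k))

theorem norm_toEuclideanLin_le_of_mem_clarkeJacobian (hΦ : LipschitzWith K Φ)
    {y : EuclideanSpace ℝ (Fin p)} {Q : Matrix (Fin q) (Fin p) ℝ} (hQ : Q ∈ clarkeJacobian Φ y)
    (x : EuclideanSpace ℝ (Fin p)) : ‖Matrix.toEuclideanLin Q x‖ ≤ K * ‖x‖ := by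
  let eval : Matrix (Fin q) (Fin p) ℝ →ₗ[ℝ] EuclideanSpace ℝ (Fin q) :=
    Matrix.toEuclideanLin.toLinearMap.flip x
  refine mem_closedBall_zero_iff.1 (clarkeJacobian_subset
    (C := eval ⁻¹' Metric.closedBall 0 (K * ‖x‖)) ((convex_closedBall _ _).linear_preimage eval)
    (Metric.isClosed_closedBall.preimage eval.continuous_of_finiteDimensional)
    (Eventually.of_forall fun y _ => ?_) hQ)
  exact mem_closedBall_zero_iff.2 (norm_toEuclideanLin_jacobianMatrix_le hΦ y x)

theorem continuous_inner_toEuclideanLin :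
    Continuous fun w : EuclideanSpace ℝ (Fin p) × Matrix (Fin p) (Fin p) ℝ =>
      inner ℝ w.1 (Matrix.toEuclideanLin w.2 w.1) := by
  simp only [Matrix.toLpLin_apply]
  fun_prop

variable {Ψ : EuclideanSpace ℝ (Fin p) → EuclideanSpace ℝ (Fin p)} {y : EuclideanSpace ℝ (Fin p)}
  {s : Set (EuclideanSpace ℝ (Fin p))}

theorem exists_eventually_le_inner_jacobianMatrix (hΨ : LipschitzWith K Ψ) (hs : IsCompact s)
    (hpos : ∀ Q ∈ clarkeJacobian Ψ y, ∀ x ∈ s, 0 < inner ℝ x (Matrix.toEuclideanLin Q x)) :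
    ∃ η : ℝ, 0 < η ∧ ∀ᶠ y' in 𝓝 y, DifferentiableAt ℝ Ψ y' → ∀ x ∈ s,
      η ≤ inner ℝ x (Matrix.toEuclideanLin (jacobianMatrix Ψ y') x) := by
  suffices h : ∃ δ : ℝ, 0 < δ ∧ ∀ y' ∈ Metric.ball y δ, DifferentiableAt ℝ Ψ y' → ∀ x ∈ s,
      δ ≤ inner ℝ x (Matrix.toEuclideanLin (jacobianMatrix Ψ y') x) from
    h.imp fun δ hδ => ⟨hδ.1, eventually_of_mem (Metric.ball_mem_nhds y hδ.1) hδ.2⟩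
  by_contra! hcon
  choose u hu hdiff x hx hlt using fun k : ℕ => hcon (1 / ((k : ℝ) + 1)) (by positivity)
  obtain ⟨x₀, hx₀, φ, hφ, hxφ⟩ := hs.tendsto_subseq hx
  have hzero : Tendsto (fun k : ℕ => 1 / ((k : ℝ) + 1)) atTop (𝓝 0) :=
    tendsto_one_div_add_atTop_nhds_zero_nat
  have huy : Tendsto u atTop (𝓝 y) := tendsto_iff_dist_tendsto_zero.2 <|
    squeeze_zero (fun _ => dist_nonneg) (fun k => (hu k).le) hzero
  obtain ⟨V, hVmem, ψ, hψ, hV⟩ := exists_subseq_tendsto_mem_clarkeJacobian hΨ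
    (fun k => hdiff (φ k)) (huy.comp hφ.tendsto_atTop)
  have hlim := (continuous_inner_toEuclideanLin.tendsto (x₀, V)).comp
    ((hxφ.comp hψ.tendsto_atTop).prodMk_nhds hV)
  exact (hpos V hVmem x₀ hx₀).not_ge <| le_of_tendsto_of_tendsto' hlim
    (hzero.comp (hφ.comp hψ).tendsto_atTop) fun k => (hlt (φ (ψ k))).le

theorem exists_eventually_le_inner_of_mem_clarkeJacobian (hΨ : LipschitzWith K Ψ)
    (hs : IsCompact s)
    (hpos : ∀ Q ∈ clarkeJacobian Ψ y, ∀ x ∈ s, 0 < inner ℝ x (Matrix.toEuclideanLin Q x)) :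
    ∃ η : ℝ, 0 < η ∧ ∀ᶠ y' in 𝓝 y, ∀ Q ∈ clarkeJacobian Ψ y', ∀ x ∈ s,
      η ≤ inner ℝ x (Matrix.toEuclideanLin Q x) := by
  obtain ⟨η, hη, hjac⟩ := exists_eventually_le_inner_jacobianMatrix hΨ hs hpos
  refine ⟨η, hη, hjac.eventually_nhds.mono fun y' hy' Q hQ x hx => ?_⟩
  let quad : Matrix (Fin p) (Fin p) ℝ →ₗ[ℝ] ℝ :=
    (innerₗ _ x).comp (Matrix.toEuclideanLin.toLinearMap.flip x)
  exact clarkeJacobian_subset (C := {Q | η ≤ quad Q}) (convex_halfSpace_ge quad.isLinear η)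
    (isClosed_le continuous_const quad.continuous_of_finiteDimensional)
    (hy'.mono fun w hw hd => hw hd x hx) hQ

end ClarkeJacobian

section GeneralizedHessian

open scoped Matrix.Norms.Frobenius

variable {m n : ℕ} {f : EuclideanSpace ℝ (Fin n) → ℝ} {σ : ℝ} {A : Matrix (Fin m) (Fin n) ℝ}
  {z zs : EuclideanSpace ℝ (Fin m)} {H : Matrix (Fin m) (Fin m) ℝ}

theorem transpose_jacobianMatrix_gradConj (hσ : 0 < σ) (hf : StrongConvexOn univ σ f)
    {y : EuclideanSpace ℝ (Fin n)} (hy : DifferentiableAt ℝ (gradConj f) y) :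
    (jacobianMatrix (gradConj f) y).transpose = jacobianMatrix (gradConj f) y := by
  have hderiv : ∀ x, HasFDerivAt (fenchelConj f) (innerSL ℝ (gradConj f x)) x := fun x =>
    (hasGradientAt_fenchelConj hσ hf x).hasFDerivAt
  have hderiv₂ : HasFDerivAt (fun x => innerSL ℝ (gradConj f x))
      ((innerSL ℝ).comp (fderiv ℝ (gradConj f) y)) y :=
    (innerSL ℝ (E := EuclideanSpace ℝ (Fin n))).hasFDerivAt.comp y hy.hasFDerivAt
  ext i j
  simpa [jacobianMatrix, EuclideanSpace.inner_single_right] using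
    second_derivative_symmetric hderiv hderiv₂ (EuclideanSpace.single i 1)
      (EuclideanSpace.single j 1)

theorem transpose_of_mem_clarkeJacobian_gradConj (hσ : 0 < σ) (hf : StrongConvexOn univ σ f)
    {y : EuclideanSpace ℝ (Fin n)} {Q : Matrix (Fin n) (Fin n) ℝ}
    (hQ : Q ∈ clarkeJacobian (gradConj f) y) : Q.transpose = Q := by
  have hconv : Convex ℝ {Q : Matrix (Fin n) (Fin n) ℝ | Q.transpose = Q} := by
    intro M hM N hN a b _ _ _
    simp only [mem_ofPred_eq] at *
    rw [Matrix.transpose_add, Matrix.transpose_smul, Matrix.transpose_smul, hM, hN]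
  exact clarkeJacobian_subset hconv (isClosed_eq continuous_id.matrix_transpose continuous_id)
    (Eventually.of_forall fun y' hy' => transpose_jacobianMatrix_gradConj hσ hf hy') hQ

theorem isHermitian_of_mem_genHessian (hσ : 0 < σ) (hf : StrongConvexOn univ σ f)
    (hH : H ∈ genHessian f A z) : H.IsHermitian := by
  obtain ⟨Q, hQ, rfl⟩ := hH
  rw [Matrix.IsHermitian, Matrix.conjTranspose_eq_transpose_of_trivial, Matrix.transpose_mul,
    Matrix.transpose_mul, Matrix.transpose_transpose,
    transpose_of_mem_clarkeJacobian_gradConj hσ hf hQ, Matrix.mul_assoc]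

theorem genHessian_nonempty (hσ : 0 < σ) (hf : StrongConvexOn univ σ f)
    (A : Matrix (Fin m) (Fin n) ℝ) (z : EuclideanSpace ℝ (Fin m)) : (genHessian f A z).Nonempty :=
  (clarkeJacobian_nonempty (lipschitzWith_gradConj hσ hf) (negTranspose A z)).elim
    fun Q hQ => ⟨_, Q, hQ, rfl⟩

theorem inner_toEuclideanLin_mul_mul_transpose (A : Matrix (Fin m) (Fin n) ℝ)
    (Q : Matrix (Fin n) (Fin n) ℝ) (x : EuclideanSpace ℝ (Fin m)) :
    inner ℝ x (Matrix.toEuclideanLin (A * Q * A.transpose) x) =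
      inner ℝ (negTranspose A x) (Matrix.toEuclideanLin Q (negTranspose A x)) := by
  rw [toEuclideanLin_mul_mul_transpose, inner_neg_right, real_inner_comm, ← inner_negTranspose,
    real_inner_comm]

theorem inner_le_of_mem_genHessian (hσ : 0 < σ) (hf : StrongConvexOn univ σ f)
    (hH : H ∈ genHessian f A z) (x : EuclideanSpace ℝ (Fin m)) :
    inner ℝ x (Matrix.toEuclideanLin H x) ≤ lipConst A σ * ‖x‖ ^ 2 := by
  obtain ⟨Q, hQ, rfl⟩ := hH
  rw [inner_toEuclideanLin_mul_mul_transpose]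
  have hQx := norm_toEuclideanLin_le_of_mem_clarkeJacobian (lipschitzWith_gradConj hσ hf) hQ
    (negTranspose A x)
  rw [Real.coe_toNNReal _ (by positivity)] at hQx
  calc _ ≤ ‖negTranspose A x‖ * ‖Matrix.toEuclideanLin Q (negTranspose A x)‖ :=
        real_inner_le_norm _ _
    _ ≤ ‖negTranspose A x‖ * (1 / σ * ‖negTranspose A x‖) := by gcongr
    _ ≤ (‖A‖ * ‖x‖) * (1 / σ * (‖A‖ * ‖x‖)) := by gcongr <;> exact norm_negTranspose_le A x
    _ = lipConst A σ * ‖x‖ ^ 2 := by rw [lipConst_eq_norm_sq_div]; ring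

/-- Uniform coercivity, with constant `η`, of the generalized Hessians near `zs` on the coordinate
subspace of the support of `zs`: a lower bound on the spectra of the `H_S`, free of submatrices. -/
def HessianCoercive (f : EuclideanSpace ℝ (Fin n) → ℝ) (A : Matrix (Fin m) (Fin n) ℝ)
    (zs : EuclideanSpace ℝ (Fin m)) (η : ℝ) : Prop :=
  ∀ᶠ v in 𝓝 zs, ∀ H ∈ genHessian f A v, ∀ x ∈ coordSubspace (supp zs),
    η * ‖x‖ ^ 2 ≤ inner ℝ x (Matrix.toEuclideanLin H x)

theorem le_inner_of_le_spectrum {ι : Type*} [Fintype ι] [DecidableEq ι] {M : Matrix ι ι ℝ}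
    (hM : M.IsHermitian) {η : ℝ} (h : ∀ l ∈ spectrum ℝ M, η ≤ l) (d : EuclideanSpace ℝ ι) :
    η * ‖d‖ ^ 2 ≤ inner ℝ d (Matrix.toEuclideanLin M d) := by
  have hshift : (M - algebraMap ℝ (Matrix ι ι ℝ) η).PosSemidef := by
    rw [Matrix.posSemidef_iff_isHermitian_and_spectrum_nonneg]
    refine ⟨hM.sub (Matrix.isHermitian_diagonal _), fun l hl => ?_⟩
    rw [← spectrum.sub_singleton_eq] at hl
    obtain ⟨l', hl', _, rfl, rfl⟩ := hl
    exact sub_nonneg.2 (h l' hl')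
  have hquad := hshift.dotProduct_mulVec_nonneg d.ofLp
  rw [Matrix.sub_mulVec, Algebra.algebraMap_eq_smul_one, Matrix.smul_mulVec, Matrix.one_mulVec,
    dotProduct_sub, dotProduct_smul] at hquad
  rw [EuclideanSpace.real_norm_sq_eq]
  simpa [PiLp.inner_apply, dotProduct, mul_comm, ← sub_nonneg, pow_two] using hquad

theorem exists_unit_eigenvector {ι : Type*} [Fintype ι] [DecidableEq ι] {M : Matrix ι ι ℝ} {l : ℝ}
    (hl : l ∈ spectrum ℝ M) :
    ∃ d : EuclideanSpace ℝ ι, ‖d‖ = 1 ∧ inner ℝ d (Matrix.toEuclideanLin M d) = l := by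
  rw [← Matrix.spectrum_toLpLin 2, ← Module.End.hasEigenvalue_iff_mem_spectrum] at hl
  obtain ⟨v, hv⟩ := hl.exists_hasEigenvector
  have hv₀ : ‖v‖ ≠ 0 := norm_ne_zero_iff.2 hv.2
  refine ⟨‖v‖⁻¹ • v, by rw [norm_smul, norm_inv, norm_norm, inv_mul_cancel₀ hv₀], ?_⟩
  rw [map_smul, hv.apply_eq_smul, inner_smul_left, inner_smul_right, inner_smul_right,
    real_inner_self_eq_norm_sq, conj_trivial]
  field_simp

theorem EigenvalueBounds.hessianCoercive (hσ : 0 < σ) (hf : StrongConvexOn univ σ f)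
    {ε η₃ η₄ : ℝ} (h : EigenvalueBounds f A zs ε η₃ η₄) : HessianCoercive f A zs η₃ := by
  filter_upwards [Metric.ball_mem_nhds zs h.1] with v hv H hH x hx
  rw [← inner_subvec_submat H hx hx, ← norm_subvec hx]
  exact le_inner_of_le_spectrum ((isHermitian_of_mem_genHessian hσ hf hH).submatrix _)
    (fun l hl => (h.2.2.2 v hv H hH l hl).1) _

theorem SOSC.inner_pos (hs : SOSC f A zs) (hH : H ∈ genHessian f A zs)
    {x : EuclideanSpace ℝ (Fin m)} (hx : x ∈ coordSubspace (supp zs)) (hx₀ : x ≠ 0) :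
    0 < inner ℝ x (Matrix.toEuclideanLin H x) := by
  have hne : (subvec (supp zs) x).ofLp ≠ 0 := by
    rw [Ne, WithLp.ofLp_eq_zero, ← norm_eq_zero, norm_subvec hx, norm_eq_zero]
    exact hx₀
  rw [← inner_subvec_submat H hx hx]
  simpa [PiLp.inner_apply, dotProduct, mul_comm] using hs H hH _ hne

theorem SOSC.exists_hessianCoercive (hσ : 0 < σ) (hf : StrongConvexOn univ σ f)
    (hs : SOSC f A zs) : ∃ η : ℝ, 0 < η ∧ HessianCoercive f A zs η := by
  set X : Set (EuclideanSpace ℝ (Fin m)) := Metric.sphere 0 1 ∩ coordSubspace (supp zs)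
  have hX : IsCompact (negTranspose A '' X) := IsCompact.image
    ((isCompact_sphere 0 1).inter_right (Submodule.closed_of_finiteDimensional _))
    (continuous_negTranspose A)
  obtain ⟨η, hη, hcoer⟩ := exists_eventually_le_inner_of_mem_clarkeJacobian
    (lipschitzWith_gradConj hσ hf) hX (y := negTranspose A zs) <| by
      rintro Q hQ _ ⟨x, ⟨hx, hxS⟩, rfl⟩
      rw [← inner_toEuclideanLin_mul_mul_transpose]
      exact hs.inner_pos ⟨Q, hQ, rfl⟩ hxS (ne_zero_of_mem_unit_sphere ⟨x, hx⟩)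
  refine ⟨η, hη, ((continuous_negTranspose A).tendsto zs |>.eventually hcoer).mono ?_⟩
  rintro v hv _ ⟨Q, hQ, rfl⟩ x hx
  rcases eq_or_ne x 0 with rfl | hx₀
  · simp
  have hunit : ‖x‖⁻¹ • x ∈ X :=
    ⟨by simp [norm_smul, hx₀], Submodule.smul_mem _ _ hx⟩
  have h := hv Q hQ _ (mem_image_of_mem _ hunit)
  rw [← inner_toEuclideanLin_mul_mul_transpose, map_smul, inner_smul_left, inner_smul_right,
    conj_trivial] at h
  have : 0 < ‖x‖ := norm_pos_iff.2 hx₀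
  calc η * ‖x‖ ^ 2 ≤ (‖x‖⁻¹ * (‖x‖⁻¹ * _)) * ‖x‖ ^ 2 := by gcongr
    _ = _ := by field_simp

theorem HessianCoercive.exists_eigenvalueBounds (hσ : 0 < σ) (hf : StrongConvexOn univ σ f)
    {η : ℝ} (hη : 0 < η) (h : HessianCoercive f A zs η) :
    ∃ ε η₃ η₄ : ℝ, EigenvalueBounds f A zs ε η₃ η₄ := by
  obtain ⟨ε, hε, hball⟩ := Metric.eventually_nhds_iff_ball.1 h
  refine ⟨ε, η, lipConst A σ + 1, hε, hη, by linarith [lipConst_nonneg hσ A],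
    fun v hv H hH l hl => ?_⟩
  obtain ⟨d, hd, rfl⟩ := exists_unit_eigenvector hl
  obtain ⟨x, hx, rfl⟩ := exists_mem_coordSubspace_subvec_eq d
  rw [norm_subvec hx] at hd
  have hlower := hball v hv H hH x hx
  have hupper := inner_le_of_mem_genHessian hσ hf hH x
  rw [hd, one_pow, mul_one] at hlower hupper
  rw [inner_subvec_submat H hx hx]
  exact ⟨hlower, by linarith⟩

end GeneralizedHessian

section HessianRemainder

open scoped Matrix.Norms.Frobenius

variable {m n : ℕ} {f : EuclideanSpace ℝ (Fin n) → ℝ} {σ : ℝ} {A : Matrix (Fin m) (Fin n) ℝ}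
  {b zs : EuclideanSpace ℝ (Fin m)} {c c' : ℝ} {p : ℕ}

/-- The linearization error of `∇h` at `v → zs`, taken with any generalized Hessian at `v`, is at
most `c ‖v - zs‖ ^ p`. Semismoothness is the case `p = 1` with all `c > 0`, strong semismoothness
the case `p = 2` with some `c`. -/
def HessianRemainderLE (f : EuclideanSpace ℝ (Fin n) → ℝ) (A : Matrix (Fin m) (Fin n) ℝ)
    (b zs : EuclideanSpace ℝ (Fin m)) (c : ℝ) (p : ℕ) : Prop :=
  ∀ᶠ v in 𝓝 zs, ∀ H ∈ genHessian f A v,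
    ‖gradient (dualSmooth f A b) v - gradient (dualSmooth f A b) zs -
      Matrix.toEuclideanLin H (v - zs)‖ ≤ c * ‖v - zs‖ ^ p

theorem HessianRemainderLE.mono (h : HessianRemainderLE f A b zs c p) (hc : c ≤ c') :
    HessianRemainderLE f A b zs c' p :=
  Eventually.mono h fun _ hv H hH => (hv H hH).trans (by gcongr)

theorem hessianRemainderLE_of_gradConj (hσ : 0 < σ) (hf : StrongConvexOn univ σ f) (hc : 0 ≤ c)
    (h : ∀ᶠ y in 𝓝 (negTranspose A zs), ∀ Q ∈ clarkeJacobian (gradConj f) y,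
      ‖gradConj f y - gradConj f (negTranspose A zs) -
        Matrix.toEuclideanLin Q (y - negTranspose A zs)‖ ≤ c * ‖y - negTranspose A zs‖ ^ p) :
    HessianRemainderLE f A b zs (‖A‖ * (c * ‖A‖ ^ p)) p := by
  refine ((continuous_negTranspose A).tendsto zs |>.eventually h).mono ?_
  rintro v hv _ ⟨Q, hQ, rfl⟩
  set y := negTranspose A v
  set ys := negTranspose A zs
  calc _ = ‖Matrix.toEuclideanLin A
          (gradConj f y - gradConj f ys - Matrix.toEuclideanLin Q (y - ys))‖ := by
        rw [gradient_dualSmooth_sub hσ hf, toEuclideanLin_mul_mul_transpose, map_sub _ v zs,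
          map_sub _ (gradConj f y - gradConj f ys), ← norm_neg]
        congr 1
        abel
    _ ≤ ‖A‖ * (c * ‖negTranspose A (v - zs)‖ ^ p) := by
        rw [map_sub _ v zs]
        exact (norm_toEuclideanLin_le A _).trans (by gcongr; exact hv Q hQ)
    _ ≤ ‖A‖ * (c * (‖A‖ * ‖v - zs‖) ^ p) := by
        gcongr
        exact norm_negTranspose_le A _
    _ = ‖A‖ * (c * ‖A‖ ^ p) * ‖v - zs‖ ^ p := by ring

theorem Semismooth.hessianRemainderLE (hσ : 0 < σ) (hf : StrongConvexOn univ σ f)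
    (hss : Semismooth (gradConj f)) (hc : 0 < c) : HessianRemainderLE f A b zs c 1 := by
  obtain ⟨δ, hδ, h⟩ := hss.2.2 (negTranspose A zs) (c / (‖A‖ ^ 2 + 1)) (by positivity)
  refine (hessianRemainderLE_of_gradConj (c := c / (‖A‖ ^ 2 + 1)) hσ hf (by positivity)
    ?_).mono ?_
  · filter_upwards [Metric.ball_mem_nhds _ hδ] with y hy
    simpa only [add_sub_cancel, pow_one] using
      h (y - negTranspose A zs) (mem_ball_iff_norm.1 hy)
  · calc ‖A‖ * (c / (‖A‖ ^ 2 + 1) * ‖A‖ ^ 1) = c * (‖A‖ ^ 2 / (‖A‖ ^ 2 + 1)) := by ring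
      _ ≤ c * 1 := by
          gcongr
          exact (div_le_one (by positivity)).2 (by linarith)
      _ = c := mul_one c

theorem StronglySemismooth.semismooth {p q : ℕ}
    {Φ : EuclideanSpace ℝ (Fin p) → EuclideanSpace ℝ (Fin q)} (h : StronglySemismooth Φ) :
    Semismooth Φ := by
  refine ⟨h.1, h.2.1, fun x ε hε => ?_⟩
  obtain ⟨C, δ, hδ, hC⟩ := h.2.2 x
  refine ⟨min δ (ε / (|C| + 1)), by positivity, fun d hd H hH => ?_⟩
  rw [lt_min_iff, lt_div_iff₀' (by positivity)] at hd
  calc _ ≤ C * ‖d‖ ^ 2 := hC d hd.1 H hH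
    _ ≤ (|C| + 1) * ‖d‖ ^ 2 := by gcongr; linarith [le_abs_self C]
    _ = (|C| + 1) * ‖d‖ * ‖d‖ := by ring
    _ ≤ ε * ‖d‖ := by gcongr; exact hd.2.le

theorem StronglySemismooth.exists_hessianRemainderLE (hσ : 0 < σ) (hf : StrongConvexOn univ σ f)
    (hss : StronglySemismooth (gradConj f)) : ∃ C : ℝ, HessianRemainderLE f A b zs C 2 := by
  obtain ⟨C, δ, hδ, h⟩ := hss.2.2 (negTranspose A zs)
  refine ⟨_, hessianRemainderLE_of_gradConj hσ hf (abs_nonneg C) ?_⟩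
  filter_upwards [Metric.ball_mem_nhds _ hδ] with y hy Q hQ
  have hle := h (y - negTranspose A zs) (mem_ball_iff_norm.1 hy) Q
  rw [add_sub_cancel] at hle
  exact (hle hQ).trans (by gcongr; exact le_abs_self C)

end HessianRemainder

section HardThreshold

variable {κ y : ℝ}

/-- The scalar proximal map behind `proxStep`: it minimizes `(x - y)² / 2 + κ ‖x‖₀` over `x ≥ 0`. -/
noncomputable def hardThreshold (κ y : ℝ) : ℝ :=
  if √(2 * κ) < y then y else 0

theorem hardThreshold_of_ne_zero (h : hardThreshold κ y ≠ 0) :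
    √(2 * κ) < y ∧ hardThreshold κ y = y := by
  unfold hardThreshold at *
  split_ifs at * with hy
  · exact ⟨hy, rfl⟩
  · exact absurd rfl h

theorem hardThreshold_nonneg (κ y : ℝ) : 0 ≤ hardThreshold κ y := by
  unfold hardThreshold
  split_ifs with hy
  exacts [(Real.sqrt_nonneg _).trans hy.le, le_rfl]

theorem isMinOn_hardThreshold (hκ : 0 ≤ κ) (y : ℝ) :
    IsMinOn (fun x => (x - y) ^ 2 + 2 * κ * (if x = 0 then 0 else 1)) (Ici 0)
      (hardThreshold κ y) := by
  refine isMinOn_iff.2 fun x (hx : 0 ≤ x) => ?_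
  have hsq : √(2 * κ) ^ 2 = 2 * κ := Real.sq_sqrt (by positivity)
  have hs := Real.sqrt_nonneg (2 * κ)
  rcases lt_or_ge (√(2 * κ)) y with hy | hy
  · have hval : hardThreshold κ y = y := if_pos hy
    simp only [hval, (hs.trans_lt hy).ne', if_false]
    split_ifs with hx₀
    · subst hx₀
      nlinarith
    · nlinarith [sq_nonneg (x - y)]
  · have hval : hardThreshold κ y = 0 := if_neg hy.not_gt
    simp only [hval, if_true]
    split_ifs with hx₀
    · subst hx₀
      linarith
    · nlinarith [sq_nonneg (x - √(2 * κ)), mul_nonneg hx (sub_nonneg.2 hy)]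

end HardThreshold

section Descent

variable {m n : ℕ} {f : EuclideanSpace ℝ (Fin n) → ℝ} {σ : ℝ} {A : Matrix (Fin m) (Fin n) ℝ}
  {b : EuclideanSpace ℝ (Fin m)} {μ τ c₁ c₂ γ : ℝ} {z z' v w : EuclideanSpace ℝ (Fin m)}
  {i : Fin m}

theorem mem_supp : i ∈ supp z ↔ z i ≠ 0 := by
  simp [supp]

theorem card_supp_eq_sum (z : EuclideanSpace ℝ (Fin m)) :
    ((supp z).card : ℝ) = ∑ i, if z i = 0 then 0 else 1 := by
  simp [supp, Finset.card_filter, ite_not]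

theorem mem_activeSet : i ∈ activeSet f A b μ τ z ↔ √(2 * τ * μ) < gradStep f A b τ z i := by
  simp [activeSet]

theorem proxStep_apply :
    proxStep f A b μ τ z i = hardThreshold (τ * μ) (gradStep f A b τ z i) := by
  simp [proxStep, keepOn, mem_activeSet, hardThreshold, mul_assoc]

theorem proxStep_nonneg : 0 ≤ proxStep f A b μ τ z i :=
  proxStep_apply.symm ▸ hardThreshold_nonneg _ _

theorem proxStep_of_ne_zero (h : proxStep f A b μ τ z i ≠ 0) :
    √(2 * τ * μ) < proxStep f A b μ τ z i ∧
      proxStep f A b μ τ z i = gradStep f A b τ z i := by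
  rw [proxStep_apply] at h ⊢
  have hy := hardThreshold_of_ne_zero h
  rw [hy.2, mul_assoc]
  exact ⟨hy.1, rfl⟩

theorem activeSet_eq_supp_proxStep : activeSet f A b μ τ z = supp (proxStep f A b μ τ z) := by
  ext i
  rw [mem_supp]
  refine ⟨fun hi => ?_, fun h => ?_⟩
  · rw [proxStep, keepOn]
    simpa [hi] using ((Real.sqrt_nonneg _).trans_lt (mem_activeSet.1 hi)).ne'
  · exact mem_activeSet.2 ((proxStep_of_ne_zero h).1.trans_eq (proxStep_of_ne_zero h).2)

/-- The real-valued objective `h + μ ‖·‖₀`, which agrees with `dualObj` on the nonnegative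
orthant. -/
noncomputable def realObj (f : EuclideanSpace ℝ (Fin n) → ℝ) (A : Matrix (Fin m) (Fin n) ℝ)
    (b : EuclideanSpace ℝ (Fin m)) (μ : ℝ) (z : EuclideanSpace ℝ (Fin m)) : ℝ :=
  dualSmooth f A b z + μ * (supp z).card

theorem dualObj_of_nonneg (hz : ∀ i, 0 ≤ z i) : dualObj f A b μ z = (realObj f A b μ z : ℝ) := by
  rw [dualObj, sparseReg, nonnegBarrier, if_pos hz, add_zero, realObj, EReal.coe_add]

theorem dualObj_of_not_nonneg (hz : ¬ ∀ i, 0 ≤ z i) : dualObj f A b μ z = ⊤ := by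
  rw [dualObj, sparseReg, nonnegBarrier, if_neg hz, EReal.coe_add_top, EReal.coe_add_top]

theorem Accepted.nonneg {T : Finset (Fin m)} (hv : ∀ i, 0 ≤ v i)
    (h : Accepted f A b μ c₁ c₂ T v w) : ∀ i, 0 ≤ w i := by
  by_contra hw
  have htop := h.1
  rw [dualObj_of_nonneg hv, dualObj_of_not_nonneg hw, EReal.top_add_coe, top_le_iff] at htop
  exact EReal.coe_ne_top _ htop

theorem Accepted.realObj_le {T : Finset (Fin m)} (hc₁ : 0 ≤ c₁) (hv : ∀ i, 0 ≤ v i)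
    (h : Accepted f A b μ c₁ c₂ T v w) : realObj f A b μ w ≤ realObj f A b μ v := by
  have hle := h.1
  rw [dualObj_of_nonneg hv, dualObj_of_nonneg (h.nonneg hv)] at hle
  refine le_trans (le_add_of_nonneg_right ?_) (EReal.coe_le_coe_iff.1 hle)
  positivity

theorem Step.eq_proxStep_or_accepted (h : Step f A b μ τ c₁ c₂ γ z z') :
    z' = proxStep f A b μ τ z ∨
      Accepted f A b μ c₁ c₂ (activeSet f A b μ τ z) (proxStep f A b μ τ z) z' := by
  obtain ⟨H, -, d, -, hacc, hrej⟩ := h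
  refine or_iff_not_imp_right.2 fun hz' => hrej fun h => hz' ?_
  rwa [hacc h]

theorem Step.nonneg (h : Step f A b μ τ c₁ c₂ γ z z') (i : Fin m) : 0 ≤ z' i := by
  rcases h.eq_proxStep_or_accepted with rfl | hacc
  exacts [proxStep_nonneg, hacc.nonneg (fun _ => proxStep_nonneg) i]

theorem Step.realObj_le (hc₁ : 0 ≤ c₁) (h : Step f A b μ τ c₁ c₂ γ z z') :
    realObj f A b μ z' ≤ realObj f A b μ (proxStep f A b μ τ z) := by
  rcases h.eq_proxStep_or_accepted with rfl | hacc
  exacts [le_rfl, hacc.realObj_le hc₁ fun _ => proxStep_nonneg]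

theorem norm_proxStep_sub_sq_add_le (hμ : 0 ≤ μ) (hτ : 0 ≤ τ) (hz : ∀ i, 0 ≤ z i) :
    ‖proxStep f A b μ τ z - z‖ ^ 2 +
        2 * τ * inner ℝ (gradient (dualSmooth f A b) z) (proxStep f A b μ τ z - z) +
        2 * τ * μ * (supp (proxStep f A b μ τ z)).card ≤
      2 * τ * μ * (supp z).card := by
  set v := proxStep f A b μ τ z
  set g := gradient (dualSmooth f A b) z
  have hcoord (i : Fin m) : (v i - z i) ^ 2 + 2 * τ * (g i * (v i - z i)) +
      2 * τ * μ * (if v i = 0 then 0 else 1) ≤ 2 * τ * μ * (if z i = 0 then 0 else 1) := by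
    have hmin := isMinOn_iff.1
      (isMinOn_hardThreshold (mul_nonneg hτ hμ) (gradStep f A b τ z i)) (z i) (hz i)
    have hstep : gradStep f A b τ z i = z i - τ * g i := rfl
    rw [← proxStep_apply, hstep] at hmin
    linarith
  have hsum := Finset.sum_le_sum fun i (_ : i ∈ Finset.univ) => hcoord i
  have hsq : ∑ i, (v i - z i) ^ 2 = ‖v - z‖ ^ 2 := by simp [EuclideanSpace.real_norm_sq_eq]
  have hinner : ∑ i, g i * (v i - z i) = inner ℝ g (v - z) := by
    simp [PiLp.inner_apply, mul_comm]
  simp only [Finset.sum_add_distrib, ← Finset.mul_sum] at hsum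
  rwa [← card_supp_eq_sum, ← card_supp_eq_sum, hsq, hinner] at hsum

theorem realObj_proxStep_le (hσ : 0 < σ) (hf : StrongConvexOn univ σ f) (hμ : 0 ≤ μ) (hτ : 0 < τ)
    (hz : ∀ i, 0 ≤ z i) :
    realObj f A b μ (proxStep f A b μ τ z) +
      (1 / (2 * τ) - lipConst A σ / 2) * ‖proxStep f A b μ τ z - z‖ ^ 2 ≤ realObj f A b μ z := by
  have hdescent := dualSmooth_le (A := A) (b := b) hσ hf z (proxStep f A b μ τ z)
  have hprox := norm_proxStep_sub_sq_add_le (f := f) (A := A) (b := b) hμ hτ.le hz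
  simp only [realObj]
  set v := proxStep f A b μ τ z
  have hscaled : 1 / (2 * τ) * ‖v - z‖ ^ 2 + inner ℝ (gradient (dualSmooth f A b) z) (v - z) +
      μ * (supp v).card ≤ μ * (supp z).card := by
    have : 0 < 2 * τ := by positivity
    refine le_of_mul_le_mul_left (le_of_eq_of_le ?_ (hprox.trans_eq (mul_assoc _ _ _))) this
    field_simp
  linarith

theorem tendsto_zero_of_descent {a r : ℕ → ℝ} (hr : ∀ k, 0 ≤ r k)
    (h : ∀ k, a (k + 1) + r k ≤ a k) (hbdd : BddBelow (range a)) : Tendsto r atTop (𝓝 0) := by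
  have hanti : Antitone a := antitone_nat_of_succ_le fun k => by linarith [hr k, h k]
  have hlim := tendsto_atTop_ciInf hanti hbdd
  have hdiff : Tendsto (fun k => a k - a (k + 1)) atTop (𝓝 0) := by
    simpa using hlim.sub (hlim.comp (tendsto_add_atTop_nat 1))
  exact squeeze_zero hr (fun k => by linarith [h k]) hdiff

theorem bddBelow_range_of_mapClusterPt {X : Type*} [TopologicalSpace X] {a : ℕ → ℝ} {u : ℕ → X}
    {φ : X → ℝ} {x : X} (ha : Antitone a) (hφ : ContinuousAt φ x) (hle : ∀ k, φ (u k) ≤ a k)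
    (hx : MapClusterPt x atTop u) : BddBelow (range a) := by
  refine ⟨φ x - 1, forall_mem_range.2 fun k => le_of_not_gt fun hk => ?_⟩
  have hnear : ∀ᶠ y in 𝓝 x, φ x - 1 < φ y := hφ.eventually_const_lt (by linarith)
  obtain ⟨j, hj, hkj⟩ := ((hx.frequently hnear).and_eventually (eventually_ge_atTop k)).exists
  linarith [hle j, ha hkj]

theorem IsSequence.tendsto_proxStep_sub {z : ℕ → EuclideanSpace ℝ (Fin m)}
    (hz : IsSequence f A b μ τ c₁ c₂ γ z) (hσ : 0 < σ) (hf : StrongConvexOn univ σ f) (hμ : 0 ≤ μ)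
    (hτ : 0 < τ) (hτ' : τ * lipConst A σ < 1) (hc₁ : 0 ≤ c₁) {zs : EuclideanSpace ℝ (Fin m)}
    (hzs : MapClusterPt zs atTop z) :
    Tendsto (fun k => proxStep f A b μ τ (z k) - z k) atTop (𝓝 0) := by
  set ρ := 1 / (2 * τ) - lipConst A σ / 2
  have hρ : 0 < ρ := by
    rw [sub_pos, lt_div_iff₀ (by positivity)]
    linarith
  have hdesc (k : ℕ) : realObj f A b μ (z (k + 2)) +
      ρ * ‖proxStep f A b μ τ (z (k + 1)) - z (k + 1)‖ ^ 2 ≤ realObj f A b μ (z (k + 1)) :=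
    (add_le_add_left ((hz (k + 1)).realObj_le hc₁) _).trans
      (realObj_proxStep_le hσ hf hμ hτ (hz k).nonneg)
  have hbelow : BddBelow (range fun k => realObj f A b μ (z (k + 1))) := by
    refine bddBelow_range_of_mapClusterPt (u := fun k => z (k + 1)) (x := zs)
      (antitone_nat_of_succ_le fun k => le_trans ?_ (hdesc k))
      (continuous_dualSmooth hσ hf).continuousAt
      (fun k => le_add_of_nonneg_right (by positivity)) ?_
    · exact le_add_of_nonneg_right (by positivity)
    · rw [MapClusterPt, ← Function.comp_def z, ← Filter.map_map, Filter.map_add_atTop_eq_nat]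
      exact hzs
  have hsq := (tendsto_zero_of_descent (fun k => by positivity) hdesc hbelow).const_mul ρ⁻¹
  simp only [inv_mul_cancel_left₀ hρ.ne', mul_zero] at hsq
  refine (tendsto_add_atTop_iff_nat 1).1 (tendsto_zero_iff_norm_tendsto_zero.2 ?_)
  simpa using hsq.sqrt

end Descent

section Stationary

variable {m n : ℕ} {f : EuclideanSpace ℝ (Fin n) → ℝ} {σ : ℝ} {A : Matrix (Fin m) (Fin n) ℝ}
  {b : EuclideanSpace ℝ (Fin m)} {μ τ c₁ c₂ γ : ℝ} {x z zs : EuclideanSpace ℝ (Fin m)}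

/-- Stationarity of a point for the proximal gradient method with step size `τ`: its nonzero entries
are not below the threshold of `proxStep`, and the gradient of `h` vanishes on its support. -/
structure IsStationary (f : EuclideanSpace ℝ (Fin n) → ℝ) (A : Matrix (Fin m) (Fin n) ℝ)
    (b : EuclideanSpace ℝ (Fin m)) (μ τ : ℝ) (zs : EuclideanSpace ℝ (Fin m)) : Prop where
  sqrt_le : ∀ i ∈ supp zs, √(2 * τ * μ) ≤ zs i
  gradient_eq_zero : ∀ i ∈ supp zs, gradient (dualSmooth f A b) zs i = 0

theorem isStationary_of_tendsto_proxStep (hσ : 0 < σ) (hf : StrongConvexOn univ σ f) (hτ : τ ≠ 0)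
    {z : ℕ → EuclideanSpace ℝ (Fin m)} (hz : Tendsto z atTop (𝓝 zs))
    (hv : Tendsto (fun k => proxStep f A b μ τ (z k)) atTop (𝓝 zs)) :
    IsStationary f A b μ τ zs := by
  have hcoord (i : Fin m) := (PiLp.continuous_apply 2 (fun _ => ℝ) i).tendsto zs
  have hne {i : Fin m} (hi : i ∈ supp zs) : ∀ᶠ k in atTop, proxStep f A b μ τ (z k) i ≠ 0 :=
    ((hcoord i).comp hv).eventually_ne (mem_supp.1 hi)
  refine ⟨fun i hi => ge_of_tendsto ((hcoord i).comp hv)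
    ((hne hi).mono fun k hk => (proxStep_of_ne_zero hk).1.le), fun i hi => ?_⟩
  have hcont : Continuous (gradStep f A b τ) :=
    continuous_id.sub ((continuous_gradient_dualSmooth hσ hf).const_smul τ)
  have hstep : Tendsto (fun k => gradStep f A b τ (z k) i) atTop (𝓝 (zs i)) :=
    ((hcoord i).comp hv).congr' ((hne hi).mono fun k hk => (proxStep_of_ne_zero hk).2)
  have hfix : gradStep f A b τ zs i = zs i := tendsto_nhds_unique
    ((PiLp.continuous_apply 2 _ i).tendsto _ |>.comp ((hcont.tendsto zs).comp hz)) hstep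
  simpa [gradStep, hτ] using hfix

theorem IsSequence.isStationary {z : ℕ → EuclideanSpace ℝ (Fin m)}
    (hz : IsSequence f A b μ τ c₁ c₂ γ z) (hσ : 0 < σ) (hf : StrongConvexOn univ σ f) (hμ : 0 ≤ μ)
    (hτ : 0 < τ) (hτ' : τ * lipConst A σ < 1) (hc₁ : 0 ≤ c₁) (hzs : MapClusterPt zs atTop z) :
    IsStationary f A b μ τ zs := by
  obtain ⟨φ, hφ, hzφ⟩ := hzs.tendsto_subseq
  refine isStationary_of_tendsto_proxStep hσ hf hτ.ne' hzφ ?_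
  simpa using ((hz.tendsto_proxStep_sub hσ hf hμ hτ hτ' hc₁ hzs).comp hφ.tendsto_atTop).add hzφ

namespace IsStationary

theorem inner_gradient_eq_zero (h : IsStationary f A b μ τ zs) (hx : x ∈ coordSubspace (supp zs)) :
    inner ℝ (gradient (dualSmooth f A b) zs) x = 0 := by
  rw [PiLp.inner_apply]
  refine Finset.sum_eq_zero fun i _ => ?_
  by_cases hi : i ∈ supp zs
  · simp [h.gradient_eq_zero i hi]
  · simp [hx i hi]

theorem norm_subvec_gradient_le (h : IsStationary f A b μ τ zs) (hσ : 0 < σ)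
    (hf : StrongConvexOn univ σ f) (w : EuclideanSpace ℝ (Fin m)) :
    ‖subvec (supp zs) (gradient (dualSmooth f A b) w)‖ ≤ lipConst A σ * ‖w - zs‖ := by
  have hsub : subvec (supp zs) (gradient (dualSmooth f A b) w) = subvec (supp zs)
      (gradient (dualSmooth f A b) w - gradient (dualSmooth f A b) zs) := by
    ext i
    simp [subvec, h.gradient_eq_zero i i.2]
  rw [hsub]
  exact (norm_subvec_le _ _).trans (norm_gradient_dualSmooth_sub_le hσ hf w zs)

theorem eventually_supp_proxStep_eq (h : IsStationary f A b μ τ zs) (hμ : 0 < μ) (hτ : 0 < τ) :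
    ∀ᶠ z in comap (proxStep f A b μ τ) (𝓝 zs), supp (proxStep f A b μ τ z) = supp zs := by
  have : 0 < √(2 * τ * μ) := by positivity
  filter_upwards [tendsto_comap (Metric.ball_mem_nhds zs this)] with z hz
  ext i
  have hi : |proxStep f A b μ τ z i - zs i| < √(2 * τ * μ) :=
    (PiLp.norm_apply_le (proxStep f A b μ τ z - zs) i).trans_lt (mem_ball_iff_norm.1 hz)
  rw [abs_lt] at hi
  refine ⟨fun hvi => mem_supp.2 fun h₀ => ?_, fun hzi => mem_supp.2 fun h₀ => ?_⟩
  · linarith [(proxStep_of_ne_zero (mem_supp.1 hvi)).1]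
  · linarith [h.sqrt_le i hzi]

theorem norm_proxStep_sub_le (h : IsStationary f A b μ τ zs) (hσ : 0 < σ)
    (hf : StrongConvexOn univ σ f) (hτ : 0 ≤ τ) (hτ' : τ * lipConst A σ ≤ 1)
    (hz : supp (proxStep f A b μ τ z) = supp zs) :
    ‖proxStep f A b μ τ z - zs‖ ≤ 2 * ‖z - zs‖ := by
  set g := gradient (dualSmooth f A b)
  have hkeep : proxStep f A b μ τ z - zs = keepOn (supp zs) (z - zs - τ • (g z - g zs)) := by
    rw [proxStep, activeSet_eq_supp_proxStep, hz]
    ext i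
    by_cases hi : i ∈ supp zs
    · have hgi : g zs i = 0 := h.gradient_eq_zero i hi
      simp only [gradStep, keepOn, hi, if_true, PiLp.sub_apply, PiLp.smul_apply, smul_eq_mul, hgi]
      ring
    · simp [keepOn, hi, mem_coordSubspace_supp zs i hi]
  calc ‖proxStep f A b μ τ z - zs‖ ≤ ‖z - zs - τ • (g z - g zs)‖ := hkeep ▸ norm_keepOn_le _ _
    _ ≤ ‖z - zs‖ + ‖τ • (g z - g zs)‖ := norm_sub_le _ _
    _ = ‖z - zs‖ + τ * ‖g z - g zs‖ := by rw [norm_smul, Real.norm_of_nonneg hτ]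
    _ ≤ ‖z - zs‖ + τ * (lipConst A σ * ‖z - zs‖) := by
        gcongr
        exact norm_gradient_dualSmooth_sub_le hσ hf z zs
    _ ≤ 2 * ‖z - zs‖ := by
        rw [two_mul, ← mul_assoc]
        gcongr
        exact mul_le_of_le_one_left (norm_nonneg _) hτ'

end IsStationary

end Stationary

theorem add_le_of_le_inner_gradient {E : Type*} [NormedAddCommGroup E] [InnerProductSpace ℝ E]
    [CompleteSpace E] {φ : E → ℝ} {φ' : E → E} {x y : E} {c : ℝ}
    (hφ : ∀ w ∈ segment ℝ x y, HasGradientAt φ (φ' w) w)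
    (h : ∀ w ∈ segment ℝ x y, c * ‖w - x‖ ^ 2 ≤ inner ℝ (φ' w) (w - x)) :
    φ x + c / 2 * ‖y - x‖ ^ 2 ≤ φ y := by
  set e := y - x with he
  have hseg {t : ℝ} (ht : t ∈ Icc (0 : ℝ) 1) : x + t • e ∈ segment ℝ x y := by
    rw [segment_eq_image']
    exact mem_image_of_mem _ ht
  set ψ : ℝ → ℝ := fun t => φ (x + t • e) - c / 2 * ‖e‖ ^ 2 * t ^ 2 with hψ
  have hder {t : ℝ} (ht : t ∈ Icc (0 : ℝ) 1) :
      HasDerivAt ψ (inner ℝ (φ' (x + t • e)) e - c * ‖e‖ ^ 2 * t) t := by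
    have hline : HasDerivAt (fun t : ℝ => x + t • e) e t := by
      simpa using ((hasDerivAt_id t).smul_const e).const_add x
    have hquad := (hasDerivAt_pow 2 t).const_mul (c / 2 * ‖e‖ ^ 2)
    refine (((hφ _ (hseg ht)).hasFDerivAt.comp_hasDerivAt t hline).sub hquad).congr_deriv ?_
    rw [InnerProductSpace.toDual_apply_apply]
    norm_num
    ring
  have hmono : MonotoneOn ψ (Icc 0 1) := by
    refine monotoneOn_of_deriv_nonneg (convex_Icc 0 1)
      (fun t ht => (hder ht).continuousAt.continuousWithinAt)
      (fun t ht => (hder (interior_subset ht)).differentiableAt.differentiableWithinAt)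
      fun t ht => ?_
    rw [(hder (interior_subset ht)).deriv]
    have ht₀ : 0 < t := (interior_Icc.subset ht).1
    have hw := h _ (hseg (interior_subset ht))
    rw [add_sub_cancel_left, norm_smul, Real.norm_of_nonneg ht₀.le, inner_smul_right] at hw
    refine sub_nonneg.2 (le_of_mul_le_mul_left ?_ ht₀)
    linarith
  have hle := hmono (left_mem_Icc.2 zero_le_one) (right_mem_Icc.2 zero_le_one) zero_le_one
  simp only [hψ, zero_smul, one_smul, add_zero, he, add_sub_cancel] at hle
  linarith

section Newton

variable {m n : ℕ} {f : EuclideanSpace ℝ (Fin n) → ℝ} {σ : ℝ} {A : Matrix (Fin m) (Fin n) ℝ}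
  {b : EuclideanSpace ℝ (Fin m)} {μ τ c c₁ c₂ γ η ρ θ : ℝ} {p : ℕ} {T : Finset (Fin m)}
  {H : Matrix (Fin m) (Fin m) ℝ} {d v w x z zs : EuclideanSpace ℝ (Fin m)}

theorem stepLength_eq_one (h : ∀ i ∈ T, 0 ≤ v i + d i) : stepLength T v d = 1 := by
  refine min_eq_left ?_
  split_ifs with hN
  · refine Finset.le_inf' hN _ fun i hi => ?_
    obtain ⟨hiT, hdi⟩ := Finset.mem_filter.1 hi
    rw [le_div_iff_of_neg hdi]
    linarith [h i hiT]
  · exact le_rfl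

theorem newtonStep_eq_add_keepOn (hv : v ∈ coordSubspace T)
    (h : ∀ i ∈ T, 0 ≤ (v + keepOn T d) i) : newtonStep T v d = v + keepOn T d := by
  have hd : ∀ i ∈ T, 0 ≤ v i + d i := fun i hi => by simpa [keepOn, hi] using h i hi
  ext i
  by_cases hi : i ∈ T
  · simp [newtonStep, keepOn, stepLength_eq_one hd, hi]
  · simp [newtonStep, keepOn, hi, hv i hi]

theorem NewtonEq.inner_eq (h : NewtonEq f A b γ T H v d) (hx : x ∈ coordSubspace T) :
    inner ℝ x (Matrix.toEuclideanLin H (keepOn T d)) +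
        γ * ‖subvec T (gradient (dualSmooth f A b) v)‖ * inner ℝ x (keepOn T d) =
      -inner ℝ x (gradient (dualSmooth f A b) v) := by
  rw [NewtonEq, ← subvec_keepOn T d] at h
  have htest := congrArg (fun u => inner ℝ (subvec T x) u) h
  simpa only [map_add, map_smul, LinearMap.add_apply, LinearMap.smul_apply, inner_add_right,
    inner_smul_right, inner_neg_right, Matrix.toLpLin_one, LinearMap.id_apply,
    inner_subvec_submat H hx (keepOn_mem_coordSubspace T d), inner_subvec hx] using htest

theorem NewtonEq.inner_sub_eq (h : NewtonEq f A b γ (supp zs) H v d)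
    (hs : IsStationary f A b μ τ zs) (hv : v ∈ coordSubspace (supp zs))
    {p : EuclideanSpace ℝ (Fin m)} (hp : p = v + keepOn (supp zs) d - zs) :
    inner ℝ p (Matrix.toEuclideanLin H p) +
        γ * ‖subvec (supp zs) (gradient (dualSmooth f A b) v)‖ * ‖p‖ ^ 2 =
      inner ℝ p ((γ * ‖subvec (supp zs) (gradient (dualSmooth f A b) v)‖) • (v - zs) -
        (gradient (dualSmooth f A b) v - gradient (dualSmooth f A b) zs -
          Matrix.toEuclideanLin H (v - zs))) := by
  have hpS : p ∈ coordSubspace (supp zs) := hp ▸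
    sub_mem (add_mem hv (keepOn_mem_coordSubspace _ d)) (mem_coordSubspace_supp zs)
  have hnewton := h.inner_eq hpS
  have hgs : inner ℝ p (gradient (dualSmooth f A b) zs) = 0 :=
    (real_inner_comm _ _).trans (hs.inner_gradient_eq_zero hpS)
  have hd : keepOn (supp zs) d = p - (v - zs) := by rw [hp]; abel
  rw [hd, map_sub, inner_sub_right p p, inner_sub_right, real_inner_self_eq_norm_sq] at hnewton
  rw [inner_sub_right, inner_sub_right, inner_sub_right, inner_smul_right, hgs]
  linarith

theorem NewtonEq.mul_norm_sub_le (h : NewtonEq f A b γ (supp zs) H v d)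
    (hs : IsStationary f A b μ τ zs) (hσ : 0 < σ) (hf : StrongConvexOn univ σ f) (hγ : 0 ≤ γ)
    (hv : v ∈ coordSubspace (supp zs))
    (hH : ∀ x ∈ coordSubspace (supp zs), η * ‖x‖ ^ 2 ≤ inner ℝ x (Matrix.toEuclideanLin H x)) :
    η * ‖v + keepOn (supp zs) d - zs‖ ≤
      ‖gradient (dualSmooth f A b) v - gradient (dualSmooth f A b) zs -
        Matrix.toEuclideanLin H (v - zs)‖ + γ * lipConst A σ * ‖v - zs‖ ^ 2 := by
  set p := v + keepOn (supp zs) d - zs with hp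
  have hpS : p ∈ coordSubspace (supp zs) :=
    sub_mem (add_mem hv (keepOn_mem_coordSubspace _ d)) (mem_coordSubspace_supp zs)
  have heq := h.inner_sub_eq hs hv hp
  set r := gradient (dualSmooth f A b) v - gradient (dualSmooth f A b) zs -
    Matrix.toEuclideanLin H (v - zs)
  set lam := γ * ‖subvec (supp zs) (gradient (dualSmooth f A b) v)‖
  have hlam₀ : 0 ≤ lam := by positivity
  have hlam : lam ≤ γ * (lipConst A σ * ‖v - zs‖) :=
    mul_le_mul_of_nonneg_left (hs.norm_subvec_gradient_le hσ hf v) hγ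
  have hℓ := lipConst_nonneg hσ A
  rcases (norm_nonneg p).eq_or_lt with hp₀ | hp₀
  · rw [← hp₀, mul_zero]
    positivity
  refine le_of_mul_le_mul_left ?_ hp₀
  calc ‖p‖ * (η * ‖p‖) = η * ‖p‖ ^ 2 := by ring
    _ ≤ inner ℝ p (Matrix.toEuclideanLin H p) + lam * ‖p‖ ^ 2 :=
        le_add_of_le_of_nonneg (hH p hpS) (by positivity)
    _ ≤ ‖p‖ * ‖lam • (v - zs) - r‖ := heq ▸ real_inner_le_norm _ _
    _ ≤ ‖p‖ * (lam * ‖v - zs‖ + ‖r‖) := by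
        gcongr
        simpa [norm_smul, abs_of_nonneg hlam₀] using norm_sub_le (lam • (v - zs)) r
    _ ≤ ‖p‖ * (γ * (lipConst A σ * ‖v - zs‖) * ‖v - zs‖ + ‖r‖) := by gcongr
    _ = ‖p‖ * (‖r‖ + γ * lipConst A σ * ‖v - zs‖ ^ 2) := by ring

/-- The vector `w` is obtained from `v` by a full (undamped) step of the regularized Newton method
for `h` restricted to the coordinate subspace of `T`. -/
def IsFullNewtonStep (f : EuclideanSpace ℝ (Fin n) → ℝ) (A : Matrix (Fin m) (Fin n) ℝ)
    (b : EuclideanSpace ℝ (Fin m)) (γ : ℝ) (T : Finset (Fin m))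
    (v w : EuclideanSpace ℝ (Fin m)) : Prop :=
  v ∈ coordSubspace T ∧
    ∃ H ∈ genHessian f A v, ∃ d, NewtonEq f A b γ T H v d ∧ w = v + keepOn T d

theorem IsFullNewtonStep.mem_coordSubspace (h : IsFullNewtonStep f A b γ T v w) :
    w ∈ coordSubspace T := by
  obtain ⟨hv, H, -, d, -, rfl⟩ := h
  exact add_mem hv (keepOn_mem_coordSubspace T d)

namespace IsStationary

theorem eventually_mul_norm_newton_sub_le (hs : IsStationary f A b μ τ zs) (hσ : 0 < σ)
    (hf : StrongConvexOn univ σ f) (hγ : 0 ≤ γ) (hη : HessianCoercive f A zs η)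
    (hr : HessianRemainderLE f A b zs c p) :
    ∀ᶠ v in 𝓝 zs, ∀ w, IsFullNewtonStep f A b γ (supp zs) v w →
      η * ‖w - zs‖ ≤ c * ‖v - zs‖ ^ p + γ * lipConst A σ * ‖v - zs‖ ^ 2 := by
  filter_upwards [hη, hr] with v hcoer hrem
  rintro _ ⟨hv, H, hH, d, hd, rfl⟩
  grw [hd.mul_norm_sub_le hs hσ hf hγ hv (hcoer H hH), hrem H hH]

theorem eventually_norm_newton_sub_le (hs : IsStationary f A b μ τ zs) (hσ : 0 < σ)
    (hf : StrongConvexOn univ σ f) (hγ : 0 ≤ γ) (hη : 0 < η) (hcoer : HessianCoercive f A zs η)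
    (hss : Semismooth (gradConj f)) (hθ : 0 < θ) :
    ∀ᶠ v in 𝓝 zs, ∀ w, IsFullNewtonStep f A b γ (supp zs) v w →
      ‖w - zs‖ ≤ θ * ‖v - zs‖ := by
  have hηθ : 0 < η * θ / 2 := by positivity
  have hreg : ∀ᶠ v in 𝓝 zs, γ * lipConst A σ * ‖v - zs‖ < η * θ / 2 := by
    have hcont : Continuous fun v => γ * lipConst A σ * ‖v - zs‖ := by fun_prop
    exact (hcont.tendsto zs).eventually_lt_const (by simpa using hηθ)
  filter_upwards [hreg, hs.eventually_mul_norm_newton_sub_le hσ hf hγ hcoer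
    (hss.hessianRemainderLE hσ hf hηθ)] with v hreg hv w hw
  refine le_of_mul_le_mul_left ?_ hη
  calc η * ‖w - zs‖ ≤ η * θ / 2 * ‖v - zs‖ ^ 1 + γ * lipConst A σ * ‖v - zs‖ ^ 2 := hv w hw
    _ = η * θ / 2 * ‖v - zs‖ + γ * lipConst A σ * ‖v - zs‖ * ‖v - zs‖ := by ring
    _ ≤ η * θ / 2 * ‖v - zs‖ + η * θ / 2 * ‖v - zs‖ := by gcongr
    _ = η * (θ * ‖v - zs‖) := by ring

theorem exists_eventually_norm_newton_sub_le_sq (hs : IsStationary f A b μ τ zs) (hσ : 0 < σ)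
    (hf : StrongConvexOn univ σ f) (hγ : 0 ≤ γ) (hη : 0 < η) (hcoer : HessianCoercive f A zs η)
    (hss : StronglySemismooth (gradConj f)) :
    ∃ C : ℝ, ∀ᶠ v in 𝓝 zs, ∀ w, IsFullNewtonStep f A b γ (supp zs) v w →
      ‖w - zs‖ ≤ C * ‖v - zs‖ ^ 2 := by
  obtain ⟨C, hC⟩ := hss.exists_hessianRemainderLE (A := A) (b := b) (zs := zs) hσ hf
  refine ⟨(C + γ * lipConst A σ) / η, ?_⟩
  filter_upwards [hs.eventually_mul_norm_newton_sub_le hσ hf hγ hcoer hC] with v hv w hw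
  rw [div_mul_eq_mul_div, le_div_iff₀' hη, add_mul]
  exact hv w hw

theorem eventually_mul_norm_sq_le_inner_gradient (hs : IsStationary f A b μ τ zs) (hσ : 0 < σ)
    (hf : StrongConvexOn univ σ f) (hη : HessianCoercive f A zs η)
    (hr : HessianRemainderLE f A b zs c 1) :
    ∀ᶠ v in 𝓝 zs, v ∈ coordSubspace (supp zs) →
      (η - c) * ‖v - zs‖ ^ 2 ≤ inner ℝ (gradient (dualSmooth f A b) v) (v - zs) := by
  filter_upwards [hη, hr] with v hcoer hrem hv
  obtain ⟨H, hH⟩ := genHessian_nonempty hσ hf A v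
  have he : v - zs ∈ coordSubspace (supp zs) := sub_mem hv (mem_coordSubspace_supp zs)
  have hcoerH := hcoer H hH _ he
  have hremH := hrem H hH
  set e := v - zs
  set g := gradient (dualSmooth f A b)
  set r := g v - g zs - Matrix.toEuclideanLin H e with hr_def
  have hsplit : inner ℝ (g v) e = inner ℝ e (Matrix.toEuclideanLin H e) + inner ℝ e r := by
    rw [hr_def, inner_sub_right e, inner_sub_right e, real_inner_comm e (g v),
      real_inner_comm (g zs) e, hs.inner_gradient_eq_zero he]
    ring
  calc (η - c) * ‖e‖ ^ 2 = η * ‖e‖ ^ 2 - ‖e‖ * (c * ‖e‖ ^ 1) := by ring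
    _ ≤ inner ℝ e (Matrix.toEuclideanLin H e) - ‖e‖ * ‖r‖ := by gcongr
    _ ≤ inner ℝ (g v) e := by linarith [neg_le_of_abs_le (abs_real_inner_le_norm e r)]

theorem eventually_dualSmooth_growth (hs : IsStationary f A b μ τ zs) (hσ : 0 < σ)
    (hf : StrongConvexOn univ σ f) (hη : HessianCoercive f A zs η)
    (hr : HessianRemainderLE f A b zs c 1) :
    ∀ᶠ v in 𝓝 zs, v ∈ coordSubspace (supp zs) →
      dualSmooth f A b zs + (η - c) / 2 * ‖v - zs‖ ^ 2 ≤ dualSmooth f A b v := by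
  obtain ⟨δ, hδ, hball⟩ := Metric.eventually_nhds_iff_ball.1
    (hs.eventually_mul_norm_sq_le_inner_gradient hσ hf hη hr)
  filter_upwards [Metric.ball_mem_nhds zs hδ] with v hv hvS
  refine add_le_of_le_inner_gradient (fun w _ => hasGradientAt_gradient_dualSmooth hσ hf w)
    fun w hw => hball w ?_ ?_
  · exact (convex_ball zs δ).segment_subset (Metric.mem_ball_self hδ) hv hw
  · exact (coordSubspace (supp zs)).convex.segment_subset (mem_coordSubspace_supp zs) hvS hw

theorem eventually_nonneg_and_supp_eq (hs : IsStationary f A b μ τ zs) (hμ : 0 < μ) (hτ : 0 < τ) :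
    ∀ᶠ v in 𝓝 zs, v ∈ coordSubspace (supp zs) → (∀ i, 0 ≤ v i) ∧ supp v = supp zs := by
  have hpos : ∀ᶠ v in 𝓝 zs, ∀ i ∈ supp zs, 0 < v i := (Finset.eventually_all _).2 fun i hi =>
    ((PiLp.continuous_apply 2 (fun _ => ℝ) i).tendsto zs).eventually_const_lt
      ((by positivity : 0 < √(2 * τ * μ)).trans_le (hs.sqrt_le i hi))
  filter_upwards [hpos] with v hpos hv
  refine ⟨fun i => ?_, Finset.ext fun i => ?_⟩ <;> by_cases hi : i ∈ supp zs
  · exact (hpos i hi).le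
  · exact (hv i hi).ge
  · exact iff_of_true (mem_supp.2 (hpos i hi).ne') hi
  · exact iff_of_false (fun h => mem_supp.1 h (hv i hi)) hi

theorem realObj_add_le (hs : IsStationary f A b μ τ zs) (hσ : 0 < σ) (hf : StrongConvexOn univ σ f)
    (hc₁ : 0 ≤ c₁) (hθ : c₁ * (1 + θ) ^ 2 + lipConst A σ / 2 * θ ^ 2 ≤ ρ)
    (hv : supp v = supp zs) (hw : supp w = supp zs)
    (hgrowth : dualSmooth f A b zs + ρ * ‖v - zs‖ ^ 2 ≤ dualSmooth f A b v)
    (hwv : ‖w - zs‖ ≤ θ * ‖v - zs‖) :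
    realObj f A b μ w + c₁ * ‖w - v‖ ^ 2 ≤ realObj f A b μ v := by
  have hℓ := lipConst_nonneg hσ A
  have hdescent := dualSmooth_le (A := A) (b := b) hσ hf zs w
  rw [hs.inner_gradient_eq_zero (sub_mem (hw ▸ mem_coordSubspace_supp w)
    (mem_coordSubspace_supp zs)), add_zero] at hdescent
  have hdist : ‖w - v‖ ≤ (1 + θ) * ‖v - zs‖ := by
    linarith [norm_sub_le_norm_sub_add_norm_sub w zs v, norm_sub_rev zs v]
  have hmodel : c₁ * ‖w - v‖ ^ 2 + lipConst A σ / 2 * ‖w - zs‖ ^ 2 ≤ ρ * ‖v - zs‖ ^ 2 := by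
    calc _ ≤ c₁ * ((1 + θ) * ‖v - zs‖) ^ 2 + lipConst A σ / 2 * (θ * ‖v - zs‖) ^ 2 := by gcongr
      _ = (c₁ * (1 + θ) ^ 2 + lipConst A σ / 2 * θ ^ 2) * ‖v - zs‖ ^ 2 := by ring
      _ ≤ ρ * ‖v - zs‖ ^ 2 := by gcongr
  rw [realObj, realObj, hv, hw]
  linarith

theorem norm_subvec_gradient_le_mul_norm_sub (hs : IsStationary f A b μ τ zs) (hσ : 0 < σ)
    (hf : StrongConvexOn univ σ f) (hc₂ : 0 ≤ c₂) (hθ : lipConst A σ * θ ≤ c₂ * (1 - θ))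
    (hwv : ‖w - zs‖ ≤ θ * ‖v - zs‖) :
    ‖subvec (supp zs) (gradient (dualSmooth f A b) w)‖ ≤ c₂ * ‖w - v‖ := by
  have hℓ := lipConst_nonneg hσ A
  have hdist : (1 - θ) * ‖v - zs‖ ≤ ‖w - v‖ := by
    linarith [norm_sub_le_norm_sub_add_norm_sub v w zs, norm_sub_rev v w]
  calc _ ≤ lipConst A σ * ‖w - zs‖ := hs.norm_subvec_gradient_le hσ hf w
    _ ≤ lipConst A σ * (θ * ‖v - zs‖) := by gcongr
    _ = lipConst A σ * θ * ‖v - zs‖ := by ring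
    _ ≤ c₂ * (1 - θ) * ‖v - zs‖ := by gcongr
    _ = c₂ * ((1 - θ) * ‖v - zs‖) := by ring
    _ ≤ c₂ * ‖w - v‖ := by gcongr

end IsStationary

theorem exists_contraction_factor {ℓ : ℝ} (hc₁ : c₁ < η / 2) (hc₂ : 0 < c₂) :
    ∃ θ ∈ Ioo (0 : ℝ) 1,
      c₁ * (1 + θ) ^ 2 + ℓ / 2 * θ ^ 2 ≤ (η - θ) / 2 ∧ ℓ * θ ≤ c₂ * (1 - θ) := by
  have hdecrease : ∀ᶠ θ : ℝ in 𝓝 0, c₁ * (1 + θ) ^ 2 + ℓ / 2 * θ ^ 2 < (η - θ) / 2 :=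
    ContinuousAt.eventually_lt (by fun_prop) (by fun_prop) (by simpa using hc₁)
  have hgradient : ∀ᶠ θ : ℝ in 𝓝 0, ℓ * θ < c₂ * (1 - θ) :=
    ContinuousAt.eventually_lt (by fun_prop) (by fun_prop) (by simpa using hc₂)
  obtain ⟨θ, ⟨h₁, h₂⟩, hθ⟩ :=
    (((hdecrease.and hgradient).filter_mono nhdsWithin_le_nhds).and
      (Ioo_mem_nhdsGT one_pos)).exists
  exact ⟨θ, hθ, h₁.le, h₂.le⟩

namespace IsStationary

theorem eventually_nonneg_and_accepted (hs : IsStationary f A b μ τ zs) (hσ : 0 < σ)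
    (hf : StrongConvexOn univ σ f) (hμ : 0 < μ) (hτ : 0 < τ) (hγ : 0 ≤ γ) (hc₁ : 0 ≤ c₁)
    (hc₁' : c₁ < η / 2) (hc₂ : 0 < c₂) (hcoer : HessianCoercive f A zs η)
    (hss : Semismooth (gradConj f)) :
    ∀ᶠ v in 𝓝 zs, ∀ w, IsFullNewtonStep f A b γ (supp zs) v w →
      (∀ i, 0 ≤ w i) ∧ Accepted f A b μ c₁ c₂ (supp zs) v w := by
  obtain ⟨θ, ⟨hθ, hθ'⟩, hdecrease, hgradient⟩ :=
    exists_contraction_factor (ℓ := lipConst A σ) hc₁' hc₂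
  have hsupp := hs.eventually_nonneg_and_supp_eq hμ hτ
  obtain ⟨δ, hδ, hball⟩ := Metric.eventually_nhds_iff_ball.1 hsupp
  filter_upwards [hsupp, hs.eventually_dualSmooth_growth hσ hf hcoer (hss.hessianRemainderLE hσ hf
    hθ), hs.eventually_norm_newton_sub_le hσ hf hγ (by linarith) hcoer hss hθ,
    Metric.ball_mem_nhds zs hδ] with v hv hgrowth hwv hvδ w hw
  have hwδ : w ∈ Metric.ball zs δ := mem_ball_iff_norm.2 <| ((hwv w hw).trans
    (mul_le_of_le_one_left (norm_nonneg _) hθ'.le)).trans_lt (mem_ball_iff_norm.1 hvδ)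
  obtain ⟨hv₀, hvS⟩ := hv hw.1
  obtain ⟨hw₀, hwS⟩ := hball w hwδ hw.mem_coordSubspace
  refine ⟨hw₀, ?_, hs.norm_subvec_gradient_le_mul_norm_sub hσ hf hc₂.le hgradient (hwv w hw)⟩
  rw [dualObj_of_nonneg hv₀, dualObj_of_nonneg hw₀]
  exact_mod_cast hs.realObj_add_le hσ hf hc₁ hdecrease hvS hwS (hgrowth hw.1) (hwv w hw)

theorem eventually_isFullNewtonStep (hs : IsStationary f A b μ τ zs) (hσ : 0 < σ)
    (hf : StrongConvexOn univ σ f) (hμ : 0 < μ) (hτ : 0 < τ) (hγ : 0 ≤ γ) (hc₁ : 0 ≤ c₁)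
    (hc₁' : c₁ < η / 2) (hc₂ : 0 < c₂) (hcoer : HessianCoercive f A zs η)
    (hss : Semismooth (gradConj f)) :
    ∀ᶠ z in comap (proxStep f A b μ τ) (𝓝 zs), ∀ z', Step f A b μ τ c₁ c₂ γ z z' →
      IsFullNewtonStep f A b γ (supp zs) (proxStep f A b μ τ z) z' := by
  filter_upwards [hs.eventually_supp_proxStep_eq hμ hτ, tendsto_comap.eventually
    (hs.eventually_nonneg_and_accepted hσ hf hμ hτ hγ hc₁ hc₁' hc₂ hcoer hss)] with z hz hacc
  rintro z' ⟨H, hH, d, hd, hz', -⟩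
  rw [activeSet_eq_supp_proxStep, hz] at hd hz'
  have hv : proxStep f A b μ τ z ∈ coordSubspace (supp zs) := hz ▸ mem_coordSubspace_supp _
  have hfull : IsFullNewtonStep f A b γ (supp zs) (proxStep f A b μ τ z)
      (proxStep f A b μ τ z + keepOn (supp zs) d) := ⟨hv, H, hH, d, hd, rfl⟩
  obtain ⟨hw₀, hw⟩ := hacc _ hfull
  rw [newtonStep_eq_add_keepOn hv fun i _ => hw₀ i] at hz'
  rwa [hz' hw]

end IsStationary

end Newton

theorem tendsto_of_mapClusterPt_of_contraction {X : Type*} [PseudoMetricSpace X] {z : ℕ → X}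
    {x : X} {r : ℝ} (hr₀ : 0 ≤ r) (hr : r < 1) (hx : MapClusterPt x atTop z)
    (h : ∀ᶠ k in atTop ⊓ comap z (𝓝 x), dist (z (k + 1)) x ≤ r * dist (z k) x) :
    Tendsto z atTop (𝓝 x) := by
  obtain ⟨⟨K, δ⟩, ⟨-, hδ⟩, hK⟩ :=
    (atTop_basis.inf (Metric.nhds_basis_ball.comap z)).eventually_iff.1 h
  obtain ⟨N, hN, hNδ⟩ := frequently_atTop.1 (hx.frequently (Metric.ball_mem_nhds x hδ)) K
  have hgeom (j : ℕ) : dist (z (j + N)) x ≤ r ^ j * dist (z N) x := by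
    induction j with
    | zero => simp
    | succ j ih =>
      have hball : dist (z (j + N)) x < δ := (ih.trans (mul_le_of_le_one_left dist_nonneg
        (pow_le_one₀ hr₀ hr.le))).trans_lt hNδ
      calc dist (z (j + 1 + N)) x ≤ r * dist (z (j + N)) x := by
            rw [add_right_comm]
            exact hK ⟨le_add_left hN, hball⟩
        _ ≤ r * (r ^ j * dist (z N) x) := by gcongr
        _ = r ^ (j + 1) * dist (z N) x := by ring
  refine (tendsto_add_atTop_iff_nat N).1 (tendsto_iff_dist_tendsto_zero.2 ?_)
  exact squeeze_zero (fun _ => dist_nonneg) hgeom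
    (by simpa using (tendsto_pow_atTop_nhds_zero_of_lt_one hr₀ hr).mul_const (dist (z N) x))

section Convergence

variable {m n : ℕ} {f : EuclideanSpace ℝ (Fin n) → ℝ} {σ : ℝ} {A : Matrix (Fin m) (Fin n) ℝ}
  {b : EuclideanSpace ℝ (Fin m)} {μ τ c₁ c₂ γ η θ : ℝ} {z : ℕ → EuclideanSpace ℝ (Fin m)}
  {zs : EuclideanSpace ℝ (Fin m)}

namespace IsStationary

theorem eventually_norm_step_sub_le (hs : IsStationary f A b μ τ zs) (hσ : 0 < σ)
    (hf : StrongConvexOn univ σ f) (hμ : 0 < μ) (hτ : 0 < τ) (hτ' : τ * lipConst A σ ≤ 1)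
    (hγ : 0 ≤ γ) (hc₁ : 0 ≤ c₁) (hc₁' : c₁ < η / 2) (hc₂ : 0 < c₂)
    (hcoer : HessianCoercive f A zs η) (hss : Semismooth (gradConj f)) (hθ : 0 < θ) :
    ∀ᶠ z in comap (proxStep f A b μ τ) (𝓝 zs), ∀ z', Step f A b μ τ c₁ c₂ γ z z' →
      ‖z' - zs‖ ≤ θ * ‖z - zs‖ := by
  have hη : 0 < η := by linarith
  filter_upwards [hs.eventually_supp_proxStep_eq hμ hτ,
    hs.eventually_isFullNewtonStep hσ hf hμ hτ hγ hc₁ hc₁' hc₂ hcoer hss,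
    tendsto_comap.eventually
      (hs.eventually_norm_newton_sub_le hσ hf hγ hη hcoer hss (half_pos hθ))]
    with z hsupp hfull hnewton z' hz'
  calc ‖z' - zs‖ ≤ θ / 2 * ‖proxStep f A b μ τ z - zs‖ := hnewton z' (hfull z' hz')
    _ ≤ θ / 2 * (2 * ‖z - zs‖) := by
        gcongr
        exact hs.norm_proxStep_sub_le hσ hf hτ.le hτ' hsupp
    _ = θ * ‖z - zs‖ := by ring

theorem exists_eventually_norm_step_sub_le_sq (hs : IsStationary f A b μ τ zs) (hσ : 0 < σ)
    (hf : StrongConvexOn univ σ f) (hμ : 0 < μ) (hτ : 0 < τ) (hτ' : τ * lipConst A σ ≤ 1)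
    (hγ : 0 ≤ γ) (hc₁ : 0 ≤ c₁) (hc₁' : c₁ < η / 2) (hc₂ : 0 < c₂)
    (hcoer : HessianCoercive f A zs η) (hss : StronglySemismooth (gradConj f)) :
    ∃ C : ℝ, ∀ᶠ z in comap (proxStep f A b μ τ) (𝓝 zs), ∀ z', Step f A b μ τ c₁ c₂ γ z z' →
      ‖z' - zs‖ ≤ C * ‖z - zs‖ ^ 2 := by
  have hη : 0 < η := by linarith
  obtain ⟨C, hC⟩ := hs.exists_eventually_norm_newton_sub_le_sq hσ hf hγ hη hcoer hss
  refine ⟨|C| * 2 ^ 2, ?_⟩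
  filter_upwards [hs.eventually_supp_proxStep_eq hμ hτ,
    hs.eventually_isFullNewtonStep hσ hf hμ hτ hγ hc₁ hc₁' hc₂ hcoer
      hss.semismooth,
    tendsto_comap.eventually hC] with z hsupp hfull hnewton z' hz'
  calc ‖z' - zs‖ ≤ C * ‖proxStep f A b μ τ z - zs‖ ^ 2 := hnewton z' (hfull z' hz')
    _ ≤ |C| * (2 * ‖z - zs‖) ^ 2 := by
        gcongr
        · exact le_abs_self C
        · exact hs.norm_proxStep_sub_le hσ hf hτ.le hτ' hsupp
    _ = |C| * 2 ^ 2 * ‖z - zs‖ ^ 2 := by ring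

end IsStationary

namespace IsSequence

theorem tendsto_comap_proxStep (hz : IsSequence f A b μ τ c₁ c₂ γ z) (hσ : 0 < σ)
    (hf : StrongConvexOn univ σ f) (hμ : 0 ≤ μ) (hτ : 0 < τ) (hτ' : τ * lipConst A σ < 1)
    (hc₁ : 0 ≤ c₁) (hzs : MapClusterPt zs atTop z) :
    Tendsto z (atTop ⊓ comap z (𝓝 zs)) (comap (proxStep f A b μ τ) (𝓝 zs)) := by
  refine tendsto_comap_iff.2 ?_
  have hz_inf : Tendsto z (atTop ⊓ comap z (𝓝 zs)) (𝓝 zs) := tendsto_comap.mono_left inf_le_right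
  simpa [Function.comp_def] using
    ((hz.tendsto_proxStep_sub hσ hf hμ hτ hτ' hc₁ hzs).mono_left inf_le_left).add hz_inf

theorem tendsto_of_mapClusterPt (hz : IsSequence f A b μ τ c₁ c₂ γ z) (hσ : 0 < σ)
    (hf : StrongConvexOn univ σ f) (hμ : 0 < μ) (hτ : 0 < τ) (hτ' : τ * lipConst A σ < 1)
    (hγ : 0 ≤ γ) (hc₁ : 0 ≤ c₁) (hc₁' : c₁ < η / 2) (hc₂ : 0 < c₂)
    (hcoer : HessianCoercive f A zs η) (hss : Semismooth (gradConj f))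
    (hzs : MapClusterPt zs atTop z) : Tendsto z atTop (𝓝 zs) := by
  have hs := hz.isStationary hσ hf hμ.le hτ hτ' hc₁ hzs
  refine tendsto_of_mapClusterPt_of_contraction (r := 1 / 2) (by norm_num) (by norm_num) hzs ?_
  filter_upwards [(hz.tendsto_comap_proxStep hσ hf hμ.le hτ hτ' hc₁ hzs).eventually
    (hs.eventually_norm_step_sub_le hσ hf hμ hτ hτ'.le hγ hc₁ hc₁' hc₂ hcoer hss one_half_pos)]
    with k hk
  simpa only [dist_eq_norm] using hk _ (hz k)

theorem tendsto_atTop_comap_proxStep (hz : IsSequence f A b μ τ c₁ c₂ γ z) (hσ : 0 < σ)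
    (hf : StrongConvexOn univ σ f) (hμ : 0 ≤ μ) (hτ : 0 < τ) (hτ' : τ * lipConst A σ < 1)
    (hc₁ : 0 ≤ c₁) (hzs : Tendsto z atTop (𝓝 zs)) :
    Tendsto z atTop (comap (proxStep f A b μ τ) (𝓝 zs)) :=
  (hz.tendsto_comap_proxStep hσ hf hμ hτ hτ' hc₁ hzs.mapClusterPt).mono_left
    (le_inf le_rfl hzs.le_comap)

theorem isLittleO_norm_sub (hz : IsSequence f A b μ τ c₁ c₂ γ z) (hσ : 0 < σ)
    (hf : StrongConvexOn univ σ f) (hμ : 0 < μ) (hτ : 0 < τ) (hτ' : τ * lipConst A σ < 1)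
    (hγ : 0 ≤ γ) (hc₁ : 0 ≤ c₁) (hc₁' : c₁ < η / 2) (hc₂ : 0 < c₂)
    (hcoer : HessianCoercive f A zs η) (hss : Semismooth (gradConj f))
    (hzs : Tendsto z atTop (𝓝 zs)) :
    (fun k => ‖z (k + 1) - zs‖) =o[atTop] fun k => ‖z k - zs‖ := by
  have hs := hz.isStationary hσ hf hμ.le hτ hτ' hc₁ hzs.mapClusterPt
  refine Asymptotics.isLittleO_iff.2 fun θ hθ => ?_
  filter_upwards [(hz.tendsto_atTop_comap_proxStep hσ hf hμ.le hτ hτ' hc₁ hzs).eventually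
    (hs.eventually_norm_step_sub_le hσ hf hμ hτ hτ'.le hγ hc₁ hc₁' hc₂ hcoer hss hθ)] with k hk
  simpa only [norm_norm] using hk _ (hz k)

theorem isBigO_norm_sub_sq (hz : IsSequence f A b μ τ c₁ c₂ γ z) (hσ : 0 < σ)
    (hf : StrongConvexOn univ σ f) (hμ : 0 < μ) (hτ : 0 < τ) (hτ' : τ * lipConst A σ < 1)
    (hγ : 0 ≤ γ) (hc₁ : 0 ≤ c₁) (hc₁' : c₁ < η / 2) (hc₂ : 0 < c₂)
    (hcoer : HessianCoercive f A zs η) (hss : StronglySemismooth (gradConj f))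
    (hzs : Tendsto z atTop (𝓝 zs)) :
    (fun k => ‖z (k + 1) - zs‖) =O[atTop] fun k => ‖z k - zs‖ ^ 2 := by
  have hs := hz.isStationary hσ hf hμ.le hτ hτ' hc₁ hzs.mapClusterPt
  obtain ⟨C, hC⟩ := hs.exists_eventually_norm_step_sub_le_sq hσ hf hμ hτ hτ'.le hγ hc₁ hc₁' hc₂
    hcoer hss
  refine Asymptotics.IsBigO.of_bound C ?_
  filter_upwards [(hz.tendsto_atTop_comap_proxStep hσ hf hμ.le hτ hτ' hc₁ hzs).eventually hC]
    with k hk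
  simpa only [norm_pow, norm_norm] using hk _ (hz k)

end IsSequence

end Convergence

end SGSN

theorem theorem4p2_general {m n : ℕ} (f : EuclideanSpace ℝ (Fin n) → ℝ) (σ : ℝ) (hσ : 0 < σ)
    (hf : StrongConvexOn univ σ f) (A : Matrix (Fin m) (Fin n) ℝ) (b : EuclideanSpace ℝ (Fin m))
    (μ : ℝ) (hμ : 0 < μ) (τ c₁ c₂ γ : ℝ) (hτ : 0 < τ) (hτ' : τ * SGSN.lipConst A σ < 1)
    (hc₁ : 0 ≤ c₁) (hc₂ : 0 < c₂) (hγ : 0 ≤ γ) (z : ℕ → EuclideanSpace ℝ (Fin m))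
    (hz : SGSN.IsSequence f A b μ τ c₁ c₂ γ z) (hss : SGSN.Semismooth (SGSN.gradConj f))
    (zs : EuclideanSpace ℝ (Fin m)) (hacc : MapClusterPt zs atTop z) :
    (SGSN.SOSC f A zs → ∃ ε η₃ η₄ : ℝ, SGSN.EigenvalueBounds f A zs ε η₃ η₄) ∧
    ∀ ε η₃ η₄ : ℝ, SGSN.EigenvalueBounds f A zs ε η₃ η₄ → c₁ < η₃ / 2 →
      Tendsto z atTop (𝓝 zs) ∧
      (fun k => ‖z (k + 1) - zs‖) =o[atTop] (fun k => ‖z k - zs‖) ∧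
      (SGSN.StronglySemismooth (SGSN.gradConj f) →
        (fun k => ‖z (k + 1) - zs‖) =O[atTop] fun k => ‖z k - zs‖ ^ 2) := by
  refine ⟨fun hsosc => ?_, fun ε η₃ η₄ hE hc₁' => ?_⟩
  · obtain ⟨η, hη, hcoer⟩ := hsosc.exists_hessianCoercive hσ hf
    exact hcoer.exists_eigenvalueBounds hσ hf hη
  have hcoer := hE.hessianCoercive hσ hf
  have hconv := hz.tendsto_of_mapClusterPt hσ hf hμ hτ hτ' hγ hc₁ hc₁' hc₂ hcoer hss hacc
  exact ⟨hconv, hz.isLittleO_norm_sub hσ hf hμ hτ hτ' hγ hc₁ hc₁' hc₂ hcoer hss hconv,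
    fun hsss => hz.isBigO_norm_sub_sq hσ hf hμ hτ hτ' hγ hc₁ hc₁' hc₂ hcoer hsss hconv⟩

theorem theorem4p2 {m n : ℕ}
    -- problem data: a real-valued strongly convex function, a matrix, a vector, a weight
    (f : EuclideanSpace ℝ (Fin n) → ℝ) (σ : ℝ) (hσ : 0 < σ) (hf : StrongConvexOn Set.univ σ f)
    (A : Matrix (Fin m) (Fin n) ℝ) (b : EuclideanSpace ℝ (Fin m)) (μ : ℝ) (hμ : 0 < μ)
    -- parameters of the method; the bound on `τ` is `τ < 1 / ℓ_h`, read as no bound if `ℓ_h = 0`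
    (τ c₁ c₂ γ : ℝ) (hτ : 0 < τ) (hτ' : τ * SGSN.lipConst A σ < 1)
    (hc₁ : 0 < c₁) (hc₂ : 0 < c₂) (hγ : 0 < γ)
    -- a bounded sequence of iterates
    (z : ℕ → EuclideanSpace ℝ (Fin m)) (hz : SGSN.IsSequence f A b μ τ c₁ c₂ γ z)
    (hbdd : Bornology.IsBounded (Set.range z))
    -- semismoothness, and an accumulation point satisfying the second-order condition
    (hss : SGSN.Semismooth (SGSN.gradConj f))
    (zs : EuclideanSpace ℝ (Fin m)) (hacc : MapClusterPt zs Filter.atTop z)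
    (hsosc : SGSN.SOSC f A zs) :
    (∃ ε η₃ η₄ : ℝ, SGSN.EigenvalueBounds f A zs ε η₃ η₄) ∧
    ∀ ε η₃ η₄ : ℝ, SGSN.EigenvalueBounds f A zs ε η₃ η₄ →
      c₁ ≤ η₃ / 4 → SGSN.lipConst A σ + η₄ + 1 ≤ c₂ →
      Filter.Tendsto z Filter.atTop (nhds zs) ∧
      Asymptotics.IsLittleO Filter.atTop (fun k => ‖z (k + 1) - zs‖) (fun k => ‖z k - zs‖) ∧
      (SGSN.StronglySemismooth (SGSN.gradConj f) →
        Asymptotics.IsBigO Filter.atTop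
          (fun k => ‖z (k + 1) - zs‖) (fun k => ‖z k - zs‖ ^ 2)) := by
  obtain ⟨hbounds, hrate⟩ :=
    theorem4p2_general f σ hσ hf A b μ hμ τ c₁ c₂ γ hτ hτ' hc₁.le hc₂ hγ.le z hz hss zs hacc
  exact ⟨hbounds hsosc, fun ε η₃ η₄ hE hc _ => hrate ε η₃ η₄ hE (by linarith [hE.2.1])⟩
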